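/- Let $\mathcal X$ be a measurable space and consider distributions $P$ of $(X,Y)$ on $\mathcal X\times\{-1,+1\}$. A predictor is a measurable $f:\mathcal X\to D$ with $D\subseteq\mathbb R$; it predicts the label $+1$ where $f\ge 0$ and $-1$ where $f<0$. Let $L_{01}(f)$ be the probability of a wrong label. For a loss $l(\hat y,y)\ge 0$, a function $\psi:[0,1]\to[0,\infty)$ is a link function if it is continuous, non-decreasing, and for every $P$ and every predictor $f$ $$\psi\Big(L_{01}(f)-\inf_g L_{01}(g)\Big)\le \mathbb E[l(f(X),Y)]-\inf_g\mathbb E[l(g(X),Y)],$$ the infima being over all predictors; $l$ is a surrogate of the binary loss if it has a link function. With $C_p(\hat y)=p\,l(\hat y,1)+(1-p)\,l(\hat y,-1)$, $H(p)=\inf_{\hat y\in D}C_p(\hat y)$ and $H^-(p)=\inf_{\hat y\in D,\ \hat y(2p-1)\le 0}C_p(\hat y)$, the Bartlett $\psi$-transform of $l$ is the biconjugate on $[0,1]$ of $\tilde\psi(z)=H^-(\frac{1+z}2)-H(\frac{1+z}2)$, i.e. the function whose epigraph is the closed convex hull of that of $\tilde\psi$. A loss $\tilde l$, continuous in $\hat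 y$, is an equivalent loss for an uncertainty $U(\hat y)$ and a loss $l$ if $\partial\tilde l/\partial\hat y=U\cdot\partial l/\partial\hat y$ in the interior of $D$ (in case 4 below, except at $\hat y=\pm\gamma$). Let $\mathrm{Li}_2(z)=-\int_0^z\frac{\log(1-u)}u\,du$ and $0\log 0=0$. In each of the following four cases, $\tilde l$ is a non-negative equivalent loss for the given pair and a surrogate of the binary loss, and the given function is a link function, with the given behaviour as $z\to0$. In cases 1–3 the given function is the Bartlett $\psi$-transform of $\tilde l$. 1. Entropy uncertainty $U=-q\log q-(1-q)\log(1-q)$ and cross-entropy loss $l=-\mathbb 1\{y=1\}\log q-\mathbb 1\{y=-1\}\log(1-q)$, where $D=[-1,1]$ and $q=\frac{1+\hat y}2$: $$\tilde l=q\log q+(1-q)\log(1-q)-\mathbb 1\{y=1\}\mathrm{Li}_2(q)-\mathbb 1\{y=-1\}\mathrm{Li}_2(1-q)+\mathrm{Li}_2(1),$$ $$\psi(z)=\tfrac{1+z}2\mathrm{Li}_2\big(\tfrac{1+z}2\big)+\tfrac{1-z}2\mathrm{Li}_2\big(\tfrac{1-z}2\big)-\mathrm{Li}_2\big(\tfrac12\big)-\tfrac{1+z}2\log(1+z)-\tfrac{1-z}2\log(1-z)=\tfrac{\log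 2}{2}z^2+o(z^2).$$ 2. Least-confidence uncertainty $U=\min\{q,1-q\}$ and cross-entropy loss, with $D$ and $q$ as in case 1: $\tilde l=-\mathbb 1\{y=-1\}\log(2(1-q))-q+\log 2$ if $q<\frac12$, and $\tilde l=-\mathbb 1\{y=1\}\log(2q)-(1-q)+\log 2$ if $q\ge\frac12$; $$\psi(z)=\tfrac{1+z}2\log(1+z)-\tfrac z2=\tfrac14z^2+o(z^2).$$ 3. Margin-based uncertainty $U=\frac1{1+\mu|\hat y|}$ with $\mu>0$ and squared hinge loss $l=\max\{0,1-y\hat y\}^2$, where $D=\mathbb R$: with $s=y\hat y$ and $C=\frac2\mu(\frac1\mu+1)\log(1+\mu)-\frac2\mu$, $\tilde l=-\frac2\mu(\frac1\mu-1)\log(1-\mu s)-\frac2\mu s+C$ if $s\le0$, $\tilde l=-\frac2\mu(\frac1\mu+1)\log(1+\mu s)+\frac2\mu s+C$ if $0<s<1$, and $\tilde l=0$ if $s\ge1$; $$\psi_\mu(z)=\tfrac2{\mu^2}(1+\mu z)\log(1+\mu z)-\tfrac2\mu z=z^2+o(z^2).$$ 4. Threshold uncertainty $U=\mathbb 1\{|\hat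 y|\le\gamma\}$ with $\gamma>0$ and logistic loss $l=\log(1+e^{-y\hat y})$, where $D=\mathbb R$: $\tilde l=\log(1+e^{\gamma})$ if $y\hat y\le-\gamma$, $\tilde l=\log(1+e^{-y\hat y})$ if $-\gamma<y\hat y<\gamma$, and $\tilde l=\log(1+e^{-\gamma})$ if $y\hat y\ge\gamma$; $$\psi_\gamma(z)=\begin{cases}\frac12[(1+z)\log(1+z)+(1-z)\log(1-z)],&z\le z_0,\\ \frac12[(1+z)\log(1+z_0)+(1-z)\log(1-z_0)],&z> z_0,\end{cases}\qquad z_0=\frac{2}{\exp\big(\frac{\gamma}{1+e^{\gamma}}\big)+\exp\big(\frac{-\gamma}{1+e^{-\gamma}}\big)}-1,$$ and $\psi_\gamma(z)=\frac12z^2+o(z^2)$. Moreover $z_0\le\tanh(\gamma/2)$, and the function given by the same formula with $\tanh(\gamma/2)$ in place of $z_0$ is also a link function, is $\frac12z^2+o(z^2)$, and is the Bartlett $\psi$-transform of $\tilde l$. -/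

import Mathlib

namespace UncertaintySampling

open MeasureTheory Set
open scoped ENNReal

noncomputable section

/-! ### Binary classification, risks and link functions -/

/-- The label set `{-1, +1}`. -/
abbrev Label : Type := {y : ℝ // y = 1 ∨ y = -1}

/-- The set of measurable predictors `f : X → ℝ` whose predictions lie in `D`. -/
def predictors (X : Type*) [MeasurableSpace X] (D : Set ℝ) : Set (X → ℝ) :=
  {f | Measurable f ∧ ∀ x, f x ∈ D}

/-- The label that a real prediction stands for: its sign, with a tie counted as `+1`. -/
def predictedLabel (a : ℝ) : ℝ := if 0 ≤ a then 1 else -1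

/-- The expected binary loss of `f`. -/
def binaryRisk {X : Type*} [MeasurableSpace X] (P : Measure (X × Label)) (f : X → ℝ) : ℝ :=
  P.real {w | predictedLabel (f w.1) ≠ (w.2 : ℝ)}

/-- The binary risk of `f` in excess of the smallest one. -/
def excessBinaryRisk {X : Type*} [MeasurableSpace X] (D : Set ℝ) (P : Measure (X × Label))
    (f : X → ℝ) : ℝ :=
  binaryRisk P f - ⨅ g : predictors X D, binaryRisk P (g : X → ℝ)

/-- The expectation, in `[0, ∞]`, of a nonnegative loss `l ŷ y`. -/
def risk {X : Type*} [MeasurableSpace X] (l : ℝ → ℝ → ℝ) (P : Measure (X × Label))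
    (f : X → ℝ) : ℝ≥0∞ :=
  ∫⁻ w, ENNReal.ofReal (l (f w.1) (w.2 : ℝ)) ∂P

/-- `ψ` is a link function from the nonnegative loss `l` (with predictions in `D`) to the binary
loss. The excess risk bound is written as a sum because `risk l P f` may be infinite. -/
structure IsLinkFunction (X : Type*) [MeasurableSpace X] (D : Set ℝ) (l : ℝ → ℝ → ℝ)
    (ψ : ℝ → ℝ) : Prop where
  loss_nonneg : ∀ a ∈ D, ∀ y : Label, 0 ≤ l a (y : ℝ)
  continuousOn : ContinuousOn ψ (Icc 0 1)
  nonneg : ∀ z ∈ Icc (0 : ℝ) 1, 0 ≤ ψ z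
  monotoneOn : MonotoneOn ψ (Icc 0 1)
  bound : ∀ P : Measure (X × Label), IsProbabilityMeasure P → ∀ f ∈ predictors X D,
    (⨅ g : predictors X D, risk l P (g : X → ℝ)) + ENNReal.ofReal (ψ (excessBinaryRisk D P f))
      ≤ risk l P f

/-- The loss `l` is a surrogate of the binary loss. -/
def IsSurrogate (X : Type*) [MeasurableSpace X] (D : Set ℝ) (l : ℝ → ℝ → ℝ) : Prop :=
  ∃ ψ : ℝ → ℝ, IsLinkFunction X D l ψ

/-! ### The ψ-transform of Bartlett, Jordan and McAuliffe -/

/-- The conditional expected loss of the prediction `a` if `Y = +1` has probability `p`. -/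
def condRisk (l : ℝ → ℝ → ℝ) (p a : ℝ) : ℝ := p * l a 1 + (1 - p) * l a (-1)

/-- The optimal conditional risk `H(p)`. -/
def optRisk (D : Set ℝ) (l : ℝ → ℝ → ℝ) (p : ℝ) : ℝ :=
  ⨅ a : D, condRisk l p (a : ℝ)

/-- The optimal conditional risk `H⁻(p)` among predictions whose sign is not Bayes optimal. -/
def optRiskMinus (D : Set ℝ) (l : ℝ → ℝ → ℝ) (p : ℝ) : ℝ :=
  ⨅ a : {a : ℝ // a ∈ D ∧ a * (2 * p - 1) ≤ 0}, condRisk l p (a : ℝ)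

/-- `ψ̃(z) = H⁻((1 + z) / 2) - H((1 + z) / 2)`. -/
def psiTilde (D : Set ℝ) (l : ℝ → ℝ → ℝ) (z : ℝ) : ℝ :=
  optRiskMinus D l ((1 + z) / 2) - optRisk D l ((1 + z) / 2)

/-- The epigraph of a function on `[0, 1]`. -/
def epi (g : ℝ → ℝ) : Set (ℝ × ℝ) := {w | w.1 ∈ Icc (0 : ℝ) 1 ∧ g w.1 ≤ w.2}

/-- `ψ` is, on `[0, 1]`, the ψ-transform of `l`, the Fenchel–Legendre biconjugate of `ψ̃`:
its epigraph is the closed convex hull of the epigraph of `ψ̃`. -/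
def IsPsiTransform (D : Set ℝ) (l : ℝ → ℝ → ℝ) (ψ : ℝ → ℝ) : Prop :=
  epi ψ = closure (convexHull ℝ (epi (psiTilde D l)))

/-! ### Equivalent losses -/

/-- `l'` is an equivalent loss for the uncertainty `U` and the loss `l` on predictions in `D`:
`l'(·, y)` is continuous and `∂l'/∂ŷ = U · ∂l/∂ŷ` at all interior points of `D` outside the
exceptional set `E`. -/
def IsEquivalentLoss (D E : Set ℝ) (U : ℝ → ℝ) (l l' : ℝ → ℝ → ℝ) : Prop :=
  ∀ y : Label, ContinuousOn (fun a => l' a (y : ℝ)) D ∧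
    ∀ a ∈ interior D \ E, ∃ d : ℝ, HasDerivAt (fun b => l b (y : ℝ)) d a ∧
      HasDerivAt (fun b => l' b (y : ℝ)) (U a * d) a

/-! ### The four pairs of an uncertainty and a loss

Probabilistic models are written through `ŷ = 2 q - 1 ∈ [-1, 1]`, where `q` is the predicted
probability of the label `+1`. -/

/-- Spence's function (the dilogarithm) for real arguments `≤ 1`. -/
def Li₂ (z : ℝ) : ℝ := -∫ u in (0 : ℝ)..z, Real.log (1 - u) / u

/-- The predicted probability `q` of the label `+1`. -/
def prob (a : ℝ) : ℝ := (1 + a) / 2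

/-- The cross-entropy loss. -/
def crossEntropy (a y : ℝ) : ℝ :=
  -((if y = 1 then 1 else 0) * Real.log (prob a)
    + (if y = -1 then 1 else 0) * Real.log (1 - prob a))

/-- The entropy uncertainty. -/
def entropyUncertainty (a : ℝ) : ℝ :=
  -(prob a * Real.log (prob a) + (1 - prob a) * Real.log (1 - prob a))

/-- The equivalent loss of the entropy uncertainty and the cross-entropy loss. -/
def entropyLoss (a y : ℝ) : ℝ :=
  prob a * Real.log (prob a) + (1 - prob a) * Real.log (1 - prob a)
    - (if y = 1 then 1 else 0) * Li₂ (prob a) - (if y = -1 then 1 else 0) * Li₂ (1 - prob a)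
    + Li₂ 1

/-- The link function for the entropy uncertainty. -/
def entropyLink (z : ℝ) : ℝ :=
  (1 + z) / 2 * Li₂ ((1 + z) / 2) + (1 - z) / 2 * Li₂ ((1 - z) / 2) - Li₂ (1 / 2)
    - (1 + z) / 2 * Real.log (1 + z) - (1 - z) / 2 * Real.log (1 - z)

/-- The least confidence uncertainty. -/
def leastConfidenceUncertainty (a : ℝ) : ℝ := min (prob a) (1 - prob a)

/-- The equivalent loss of the least confidence uncertainty and the cross-entropy loss. -/
def leastConfidenceLoss (a y : ℝ) : ℝ :=
  if prob a < 1 / 2 then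
    -(if y = -1 then 1 else 0) * Real.log (2 * (1 - prob a)) - prob a + Real.log 2
  else
    -(if y = 1 then 1 else 0) * Real.log (2 * prob a) - (1 - prob a) + Real.log 2

/-- The link function for the least confidence uncertainty. -/
def leastConfidenceLink (z : ℝ) : ℝ := (1 + z) / 2 * Real.log (1 + z) - z / 2

/-- The squared hinge loss. -/
def squaredHinge (a y : ℝ) : ℝ := (max 0 (1 - y * a)) ^ 2

/-- The margin-based uncertainty. -/
def marginUncertainty (μ a : ℝ) : ℝ := 1 / (1 + μ * |a|)

/-- The equivalent loss of the margin-based uncertainty and the squared hinge loss. -/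
def marginLoss (μ a y : ℝ) : ℝ :=
  let C := 2 / μ * (1 / μ + 1) * Real.log (1 + μ) - 2 / μ
  if y * a ≤ 0 then
    -(2 / μ) * (1 / μ - 1) * Real.log (1 - μ * (y * a)) - 2 / μ * (y * a) + C
  else if y * a < 1 then
    -(2 / μ) * (1 / μ + 1) * Real.log (1 + μ * (y * a)) + 2 / μ * (y * a) + C
  else 0

/-- The link function for the margin-based uncertainty. -/
def marginLink (μ z : ℝ) : ℝ :=
  2 / μ ^ 2 * (1 + μ * z) * Real.log (1 + μ * z) - 2 / μ * z

/-- The logistic loss. -/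
def logisticLoss (a y : ℝ) : ℝ := Real.log (1 + Real.exp (-(y * a)))

/-- The threshold-based uncertainty. -/
def thresholdUncertainty (γ a : ℝ) : ℝ := if |a| ≤ γ then 1 else 0

/-- The equivalent loss of the threshold-based uncertainty and the logistic loss. -/
def thresholdLoss (γ a y : ℝ) : ℝ :=
  if y * a ≤ -γ then Real.log (1 + Real.exp γ)
  else if y * a < γ then Real.log (1 + Real.exp (-(y * a)))
  else Real.log (1 + Real.exp (-γ))

/-- The convex function `((1 + z) log (1 + z) + (1 - z) log (1 - z)) / 2`, continued by its
tangent at `z₀` to the right of `z₀`. -/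
def thresholdLink (z₀ z : ℝ) : ℝ :=
  if z ≤ z₀ then ((1 + z) * Real.log (1 + z) + (1 - z) * Real.log (1 - z)) / 2
  else ((1 + z) * Real.log (1 + z₀) + (1 - z) * Real.log (1 - z₀)) / 2

/-- The point `z₀` determined by the threshold `γ`. -/
def thresholdPoint (γ : ℝ) : ℝ :=
  2 * (Real.exp (γ / (1 + Real.exp γ)) + Real.exp (-γ / (1 + Real.exp (-γ))))⁻¹ - 1

end

end UncertaintySampling

open UncertaintySampling
open scoped Asymptotics

namespace UncertaintySampling

open MeasureTheory Set Filter Topology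
open scoped ENNReal

/-! ### Conditioning on the label -/

/-! Let η(x) be the conditional probability of the label +1. Disintegrating P over the label turns
both risks into integrals of functions of η(x) and f(x). Where the sign of f is Bayes optimal the
pointwise 0–1 regret is 0, elsewhere it is |2η - 1|. So it suffices that a wrong sign costs at least
ψ(|2η - 1|) in conditional surrogate risk; Jensen's inequality for convex ψ and the monotonicity of
ψ then integrate the bound (`isLinkFunction_of_condRisk_le`).

All four losses are invariant under (ŷ, y) ↦ (-ŷ, -y), and 0 is their best prediction among those of
the wrong sign. Hence ψ̃(z) = C(0) - min C at p = (1 + z)/2, where C(0) does not depend on p and min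
C is an infimum of functions affine in p. So ψ̃ is convex, and being nonnegative with ψ̃(0) = 0 it
is monotone. If it is also continuous, it is its own biconjugate and a link function.
`IsSymmetricGap` packages this; each case only has to identify the minimizer.

Since U is even, it multiplies the derivative of the whole conditional risk, so a positive U leaves
the minimizer in place: ŷ = 2p - 1 for cross-entropy and for squared hinge. The threshold
uncertainty freezes the logistic loss outside [-γ, γ], so the minimizer log(p/(1-p)) is capped at γ,
which it reaches at z = tanh(γ/2). A smaller point z₀ is the cap of a smaller threshold, whose gap
is smaller; this settles the stated z₀ once 0 < z₀ ≤ tanh(γ/2). -/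

/-- The label `+1`. -/
def Label.pos : Label := ⟨1, Or.inl rfl⟩

/-- The label `-1`. -/
def Label.neg : Label := ⟨-1, Or.inr rfl⟩

@[simp] theorem Label.coe_pos : (Label.pos : ℝ) = 1 := rfl

@[simp] theorem Label.coe_neg : (Label.neg : ℝ) = -1 := rfl

theorem Label.eq_pos_or_eq_neg (y : Label) : y = Label.pos ∨ y = Label.neg :=
  y.2.imp Subtype.ext Subtype.ext

theorem Label.pos_ne_neg : Label.pos ≠ Label.neg := fun h => by
  have : (1 : ℝ) = -1 := congrArg Subtype.val h
  norm_num at this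

theorem Label.univ_eq : (univ : Set Label) = {Label.pos} ∪ {Label.neg} := by
  ext y
  simpa using y.eq_pos_or_eq_neg.symm

/-- Conditional kernels need the second factor, not X, to be nonempty and standard Borel; finiteness
of the label space is what allows an arbitrary measurable X. -/
instance : Finite Label :=
  Set.finite_univ_iff.1 (by
    rw [Label.univ_eq]
    exact (finite_singleton _).union (finite_singleton _))

instance : Nonempty Label := ⟨Label.pos⟩

theorem lintegral_label (κ : Measure Label) (f : Label → ℝ≥0∞) :
    ∫⁻ y, f y ∂κ = f Label.pos * κ {Label.pos} + f Label.neg * κ {Label.neg} := by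
  rw [← setLIntegral_univ, Label.univ_eq,
    lintegral_union (measurableSet_singleton _) (by simpa using Label.pos_ne_neg),
    lintegral_singleton, lintegral_singleton]

variable {X : Type*} [MeasurableSpace X]

/-- The conditional probability of the label `+1`. -/
noncomputable def regression (P : Measure (X × Label)) [IsFiniteMeasure P] (x : X) : ℝ :=
  (P.condKernel x).real {Label.pos}

theorem measurable_regression (P : Measure (X × Label)) [IsFiniteMeasure P] :
    Measurable (regression P) :=
  (P.condKernel.measurable_coe (measurableSet_singleton Label.pos)).ennreal_toReal

theorem regression_mem_Icc (P : Measure (X × Label)) [IsFiniteMeasure P] (x : X) :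
    regression P x ∈ Icc (0 : ℝ) 1 :=
  ⟨measureReal_nonneg, measureReal_le_one⟩

theorem condKernel_real_neg (P : Measure (X × Label)) [IsFiniteMeasure P] (x : X) :
    (P.condKernel x).real {Label.neg} = 1 - regression P x := by
  have h : ({Label.neg} : Set Label) = {Label.pos}ᶜ := by
    ext y
    rcases y.eq_pos_or_eq_neg with rfl | rfl
    · simpa using Label.pos_ne_neg
    · simpa using Label.pos_ne_neg.symm
  rw [h, probReal_compl_eq_one_sub (measurableSet_singleton _), regression]

/-- The risk is the mean of the conditional risk. -/
theorem risk_eq_lintegral_condRisk (P : Measure (X × Label)) [IsFiniteMeasure P]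
    {l : ℝ → ℝ → ℝ} {f : X → ℝ} (hpos : Measurable fun x => l (f x) 1)
    (hneg : Measurable fun x => l (f x) (-1)) (hpos' : ∀ x, 0 ≤ l (f x) 1)
    (hneg' : ∀ x, 0 ≤ l (f x) (-1)) :
    risk l P f = ∫⁻ x, ENNReal.ofReal (condRisk l (regression P x) (f x)) ∂P.fst := by
  have hm : Measurable fun w : X × Label => ENNReal.ofReal (l (f w.1) (w.2 : ℝ)) := by
    refine ENNReal.measurable_ofReal.comp (measurable_from_prod_countable_left fun y => ?_)
    rcases y.eq_pos_or_eq_neg with rfl | rfl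
    exacts [hpos, hneg]
  rw [risk, ← Measure.lintegral_condKernel hm]
  refine lintegral_congr fun x => ?_
  have h0 := regression_mem_Icc P x
  rw [lintegral_label, condRisk,
    ENNReal.ofReal_add (mul_nonneg h0.1 (hpos' x)) (mul_nonneg (by linarith [h0.2]) (hneg' x)),
    ENNReal.ofReal_mul h0.1, ENNReal.ofReal_mul (by linarith [h0.2]), mul_comm,
    mul_comm (ENNReal.ofReal (l (f x) ((Label.neg : Label) : ℝ))), ← condKernel_real_neg P x]
  simp [regression]

/-- The conditional probability of a wrong label if `Y = +1` has probability `p`. -/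
noncomputable def condError (p a : ℝ) : ℝ := if 0 ≤ a then 1 - p else p

theorem condError_mem_Icc {p : ℝ} (hp : p ∈ Icc (0 : ℝ) 1) (a : ℝ) :
    condError p a ∈ Icc (0 : ℝ) 1 := by
  unfold condError
  split_ifs
  exacts [⟨by linarith [hp.2], by linarith [hp.1]⟩, hp]

theorem min_le_condError (p a : ℝ) : min p (1 - p) ≤ condError p a := by
  unfold condError
  split_ifs
  exacts [min_le_right _ _, min_le_left _ _]

theorem measurable_condError {η f : X → ℝ} (hη : Measurable η) (hf : Measurable f) :
    Measurable fun x => condError (η x) (f x) :=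
  Measurable.ite (measurableSet_le measurable_const hf) (measurable_const.sub hη) hη

theorem integrable_of_mem_Icc {ν : Measure X} [IsFiniteMeasure ν] {g : X → ℝ}
    (hg : Measurable g) (h : ∀ x, g x ∈ Icc (0 : ℝ) 1) : Integrable g ν :=
  Integrable.of_bound hg.aestronglyMeasurable 1 (ae_of_all _ fun x => by
    rw [Real.norm_eq_abs, abs_of_nonneg (h x).1]
    exact (h x).2)

theorem binaryRisk_eq_integral (P : Measure (X × Label)) [IsFiniteMeasure P] {f : X → ℝ}
    (hf : Measurable f) :
    binaryRisk P f = ∫ x, condError (regression P x) (f x) ∂P.fst := by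
  -- The 0–1 loss is treated as one more loss, so that `risk_eq_lintegral_condRisk` applies to it.
  let l : ℝ → ℝ → ℝ := fun a y => if predictedLabel a ≠ y then 1 else 0
  have hpred : Measurable fun x => predictedLabel (f x) :=
    Measurable.ite (measurableSet_le measurable_const hf) measurable_const measurable_const
  have hmeas (y : ℝ) : Measurable fun x => l (f x) y :=
    Measurable.ite (hpred (measurableSet_singleton y)).compl measurable_const measurable_const
  have hnn (a y : ℝ) : 0 ≤ l a y := by
    simp only [l]
    split_ifs <;> norm_num
  have hc (p a : ℝ) : condRisk l p a = condError p a := by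
    simp only [condRisk, condError, l, predictedLabel]
    split_ifs <;> norm_num at *
  have hset : MeasurableSet {w : X × Label | predictedLabel (f w.1) ≠ (w.2 : ℝ)} :=
    (measurableSet_eq_fun (hpred.comp measurable_fst)
      (measurable_subtype_coe.comp measurable_snd)).compl
  have h1 : P {w | predictedLabel (f w.1) ≠ (w.2 : ℝ)} = risk l P f := by
    rw [risk, ← lintegral_indicator_one hset]
    refine lintegral_congr fun w => ?_
    by_cases h : predictedLabel (f w.1) = w.2 <;> simp [l, h, indicator]
  rw [binaryRisk, measureReal_def, h1, risk_eq_lintegral_condRisk P (hmeas 1) (hmeas (-1))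
    (fun _ => hnn _ _) (fun _ => hnn _ _)]
  simp only [hc]
  rw [integral_eq_lintegral_of_nonneg_ae
    (ae_of_all _ fun x => (condError_mem_Icc (regression_mem_Icc P x) _).1)
    (measurable_condError (measurable_regression P) hf).aestronglyMeasurable]

/-! ### Excess risks, from conditional to total -/

theorem excessBinaryRisk_mem_Icc (D : Set ℝ) (P : Measure (X × Label)) [IsProbabilityMeasure P]
    {f : X → ℝ} (hf : f ∈ predictors X D) : excessBinaryRisk D P f ∈ Icc (0 : ℝ) 1 := by
  have hb : BddBelow (range fun g : predictors X D => binaryRisk P (g : X → ℝ)) :=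
    ⟨0, by rintro _ ⟨g, rfl⟩; exact measureReal_nonneg⟩
  have : Nonempty (predictors X D) := ⟨⟨f, hf⟩⟩
  refine ⟨sub_nonneg.2 (ciInf_le hb ⟨f, hf⟩), ?_⟩
  have h1 : binaryRisk P f ≤ 1 := measureReal_le_one
  have h2 : 0 ≤ ⨅ g : predictors X D, binaryRisk P (g : X → ℝ) :=
    le_ciInf fun g => measureReal_nonneg
  rw [excessBinaryRisk]
  linarith

/-- The Bayes error bounds every binary risk from below. Equality can fail, since D may lack
predictions of one sign, but a monotone ψ needs only this direction. -/
theorem excessBinaryRisk_le_integral (D : Set ℝ) (P : Measure (X × Label))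
    [IsProbabilityMeasure P] {f : X → ℝ} (hf : f ∈ predictors X D) :
    excessBinaryRisk D P f ≤ ∫ x, (condError (regression P x) (f x)
      - min (regression P x) (1 - regression P x)) ∂P.fst := by
  have : Nonempty (predictors X D) := ⟨⟨f, hf⟩⟩
  have hη := measurable_regression P
  have hmin : Integrable (fun x => min (regression P x) (1 - regression P x)) P.fst :=
    integrable_of_mem_Icc (hη.min (measurable_const.sub hη)) fun x =>
      ⟨le_min (regression_mem_Icc P x).1 (by linarith [(regression_mem_Icc P x).2]),
        (min_le_left _ _).trans (regression_mem_Icc P x).2⟩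
  have herr {g : X → ℝ} (hg : Measurable g) :
      Integrable (fun x => condError (regression P x) (g x)) P.fst :=
    integrable_of_mem_Icc (measurable_condError hη hg) fun x =>
      condError_mem_Icc (regression_mem_Icc P x) _
  rw [integral_sub (herr hf.1) hmin, ← binaryRisk_eq_integral P hf.1, excessBinaryRisk]
  refine sub_le_sub_left (le_ciInf fun g => ?_) _
  rw [binaryRisk_eq_integral P g.2.1]
  exact integral_mono hmin (herr g.2.1) fun x => min_le_condError _ _

/-- A convex function that bounds the excess conditional risk of every prediction with the wrong
sign from below is a link function. -/
theorem isLinkFunction_of_condRisk_le {D : Set ℝ} {l : ℝ → ℝ → ℝ} {ψ b : ℝ → ℝ}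
    (hnn : ∀ a ∈ D, ∀ y : Label, 0 ≤ l a (y : ℝ))
    (hl : ∀ y : Label, ContinuousOn (fun a => l a (y : ℝ)) D)
    (hψc : ContinuousOn ψ (Icc 0 1)) (hψn : ∀ z ∈ Icc (0 : ℝ) 1, 0 ≤ ψ z)
    (hψm : MonotoneOn ψ (Icc 0 1)) (hψ : ConvexOn ℝ (Icc 0 1) ψ) (hψ0 : ψ 0 = 0)
    (hb : Measurable b) (hbD : ∀ p ∈ Icc (0 : ℝ) 1, b p ∈ D)
    (hopt : ∀ p ∈ Icc (0 : ℝ) 1, ∀ a ∈ D, condRisk l p (b p) ≤ condRisk l p a)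
    (hwrong : ∀ p ∈ Icc (0 : ℝ) 1, ∀ a ∈ D, a * (2 * p - 1) ≤ 0 →
      condRisk l p (b p) + ψ |2 * p - 1| ≤ condRisk l p a) :
    IsLinkFunction X D l ψ := by
  refine ⟨hnn, hψc, hψn, hψm, fun P _ f hf => ?_⟩
  have hη := measurable_regression P
  have hηI := regression_mem_Icc P
  -- The loss is only continuous on D, so measurability is obtained by factoring g through the
  -- subtype D.
  have hlm {g : X → ℝ} (hg : g ∈ predictors X D) (y : Label) :
      Measurable fun x => l (g x) (y : ℝ) :=
    (continuousOn_iff_continuous_domRestrict.1 (hl y)).measurable.comp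
      (hg.1.subtype_mk (h := hg.2))
  have hrisk {g : X → ℝ} (hg : g ∈ predictors X D) : risk l P g =
      ∫⁻ x, ENNReal.ofReal (condRisk l (regression P x) (g x)) ∂P.fst :=
    risk_eq_lintegral_condRisk P (hlm hg Label.pos) (hlm hg Label.neg)
      (fun x => hnn _ (hg.2 x) Label.pos) (fun x => hnn _ (hg.2 x) Label.neg)
  have hg : (fun x => b (regression P x)) ∈ predictors X D :=
    ⟨hb.comp hη, fun x => hbD _ (hηI x)⟩
  have hcm {g : X → ℝ} (hg : g ∈ predictors X D) :
      Measurable fun x => condRisk l (regression P x) (g x) :=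
    (hη.mul (hlm hg Label.pos)).add ((measurable_const.sub hη).mul (hlm hg Label.neg))
  set e : X → ℝ := fun x => condError (regression P x) (f x)
    - min (regression P x) (1 - regression P x) with he
  have hem : Measurable e :=
    (measurable_condError hη hf.1).sub (hη.min (measurable_const.sub hη))
  have heI (x : X) : e x ∈ Icc (0 : ℝ) 1 :=
    ⟨sub_nonneg.2 (min_le_condError _ _), by
      have h1 := (condError_mem_Icc (hηI x) (f x)).2
      have h2 : 0 ≤ min (regression P x) (1 - regression P x) :=
        le_min (hηI x).1 (by linarith [(hηI x).2])
      simp only [he]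
      linarith⟩
  have hei : Integrable e P.fst := integrable_of_mem_Icc hem heI
  have hψem : Measurable (ψ ∘ e) :=
    (continuousOn_iff_continuous_domRestrict.1 hψc).measurable.comp (hem.subtype_mk (h := heI))
  have hψei : Integrable (ψ ∘ e) P.fst :=
    Integrable.of_bound hψem.aestronglyMeasurable (ψ 1) (ae_of_all _ fun x => by
      rw [Real.norm_eq_abs, Function.comp_apply, abs_of_nonneg (hψn _ (heI x))]
      exact hψm (heI x) ⟨zero_le_one, le_rfl⟩ (heI x).2)
  have hInt : ∫ x, e x ∂P.fst ∈ Icc (0 : ℝ) 1 := by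
    refine ⟨integral_nonneg fun x => (heI x).1, ?_⟩
    have := integral_mono hei (integrable_const (1 : ℝ)) fun x => (heI x).2
    simpa using this
  have hpt (x : X) : condRisk l (regression P x) (b (regression P x)) + ψ (e x)
      ≤ condRisk l (regression P x) (f x) := by
    have hx := hηI x
    -- Either the sign is Bayes optimal and there is no 0–1 regret, or it is wrong and the regret is
    -- |2η - 1|.
    have key : e x = 0 ∨ (f x * (2 * regression P x - 1) ≤ 0 ∧
        e x = |2 * regression P x - 1|) := by
      simp only [he, condError]
      by_cases h0 : 0 ≤ f x <;> rcases le_total (regression P x) (1 - regression P x) with h | h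
      · right
        rw [if_pos h0, min_eq_left h, abs_of_nonpos (by linarith)]
        exact ⟨mul_nonpos_of_nonneg_of_nonpos h0 (by linarith), by ring⟩
      · left
        rw [if_pos h0, min_eq_right h, sub_self]
      · left
        rw [if_neg h0, min_eq_left h, sub_self]
      · right
        rw [if_neg h0, min_eq_right h, abs_of_nonneg (by linarith)]
        exact ⟨mul_nonpos_of_nonpos_of_nonneg (not_le.1 h0).le (by linarith), by ring⟩
    rcases key with h | ⟨h, h'⟩
    · rw [h, hψ0, add_zero]
      exact hopt _ hx _ (hf.2 x)
    · rw [h']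
      exact hwrong _ hx _ (hf.2 x) h
  have hcn {g : X → ℝ} (hg : g ∈ predictors X D) (x : X) :
      0 ≤ condRisk l (regression P x) (g x) :=
    add_nonneg (mul_nonneg (hηI x).1 (hnn _ (hg.2 x) Label.pos))
      (mul_nonneg (by linarith [(hηI x).2]) (hnn _ (hg.2 x) Label.neg))
  calc (⨅ g : predictors X D, risk l P (g : X → ℝ))
        + ENNReal.ofReal (ψ (excessBinaryRisk D P f))
      ≤ risk l P (fun x => b (regression P x)) + ENNReal.ofReal (∫ x, (ψ ∘ e) x ∂P.fst) := by
        refine add_le_add (iInf_le (fun g : predictors X D => risk l P (g : X → ℝ)) ⟨_, hg⟩)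
          (ENNReal.ofReal_le_ofReal ?_)
        -- Monotonicity replaces the excess risk by the integral of e; Jensen then moves ψ inside.
        exact (hψm (excessBinaryRisk_mem_Icc D P hf) hInt
          (excessBinaryRisk_le_integral D P hf)).trans
          (hψ.map_integral_le hψc isClosed_Icc (ae_of_all _ heI) hei hψei)
    _ = ∫⁻ x, (ENNReal.ofReal (condRisk l (regression P x) (b (regression P x)))
          + ENNReal.ofReal ((ψ ∘ e) x)) ∂P.fst := by
        rw [hrisk hg, ofReal_integral_eq_lintegral_ofReal hψei
          (ae_of_all _ fun x => hψn _ (heI x)), lintegral_add_left (hcm hg).ennreal_ofReal]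
    _ ≤ ∫⁻ x, ENNReal.ofReal (condRisk l (regression P x) (f x)) ∂P.fst := by
        refine lintegral_mono fun x => ?_
        rw [Function.comp_apply, ← ENNReal.ofReal_add (hcn hg x) (hψn _ (heI x))]
        exact ENNReal.ofReal_le_ofReal (hpt x)
    _ = risk l P f := (hrisk hf).symm

/-- A smaller function inherits the bound of a link function. -/
theorem IsLinkFunction.mono {D : Set ℝ} {l : ℝ → ℝ → ℝ} {ψ φ : ℝ → ℝ}
    (h : IsLinkFunction X D l ψ) (hφc : ContinuousOn φ (Icc 0 1))
    (hφn : ∀ z ∈ Icc (0 : ℝ) 1, 0 ≤ φ z) (hφm : MonotoneOn φ (Icc 0 1))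
    (hle : ∀ z ∈ Icc (0 : ℝ) 1, φ z ≤ ψ z) : IsLinkFunction X D l φ :=
  ⟨h.loss_nonneg, hφc, hφn, hφm, fun P _ f hf =>
    (add_le_add le_rfl (ENNReal.ofReal_le_ofReal
      (hle _ (excessBinaryRisk_mem_Icc D P hf)))).trans (h.bound P inferInstance f hf)⟩

/-! ### Symmetric losses -/

/-- The loss `l` is invariant under a simultaneous change of the signs of prediction and label,
`b z` minimizes its conditional risk at `p = (1 + z) / 2` for `z ∈ [0, 1]`, `0` minimizes it among
the nonpositive predictions, and `ψ z` is the difference of the two minima. -/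
structure IsSymmetricGap (D : Set ℝ) (l : ℝ → ℝ → ℝ) (b ψ : ℝ → ℝ) : Prop where
  neg_mem : ∀ a ∈ D, -a ∈ D
  zero_mem : (0 : ℝ) ∈ D
  minimizer_mem : ∀ z ∈ Icc (0 : ℝ) 1, b z ∈ D
  measurable_minimizer : Measurable b
  loss_neg : ∀ a ∈ D, l (-a) 1 = l a (-1)
  minimizer_zero : b 0 = 0
  condRisk_minimizer_le : ∀ z ∈ Icc (0 : ℝ) 1, ∀ a ∈ D,
    condRisk l ((1 + z) / 2) (b z) ≤ condRisk l ((1 + z) / 2) a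
  condRisk_zero_le : ∀ z ∈ Icc (0 : ℝ) 1, ∀ a ∈ D, a ≤ 0 →
    condRisk l ((1 + z) / 2) 0 ≤ condRisk l ((1 + z) / 2) a
  eq_sub : ∀ z ∈ Icc (0 : ℝ) 1,
    ψ z = condRisk l ((1 + z) / 2) 0 - condRisk l ((1 + z) / 2) (b z)

namespace IsSymmetricGap

variable {D : Set ℝ} {l : ℝ → ℝ → ℝ} {b ψ : ℝ → ℝ}

theorem condRisk_neg (h : IsSymmetricGap D l b ψ) {a : ℝ} (ha : a ∈ D) (p : ℝ) :
    condRisk l (1 - p) (-a) = condRisk l p a := by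
  have h1 := h.loss_neg a ha
  have h2 := h.loss_neg (-a) (h.neg_mem a ha)
  rw [neg_neg] at h2
  simp only [condRisk, h1, h2]
  ring

theorem condRisk_zero (h : IsSymmetricGap D l b ψ) (p : ℝ) : condRisk l p 0 = l 0 1 := by
  have h1 := h.loss_neg 0 h.zero_mem
  rw [neg_zero] at h1
  rw [condRisk, ← h1]
  ring

theorem map_zero (h : IsSymmetricGap D l b ψ) : ψ 0 = 0 := by
  rw [h.eq_sub 0 ⟨le_rfl, zero_le_one⟩, h.minimizer_zero, sub_self]

theorem nonneg (h : IsSymmetricGap D l b ψ) (z : ℝ) (hz : z ∈ Icc (0 : ℝ) 1) : 0 ≤ ψ z := by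
  rw [h.eq_sub z hz]
  exact sub_nonneg.2 (h.condRisk_minimizer_le z hz 0 h.zero_mem)

/-- A constant minus an infimum of functions affine in z is convex: the minimizer at the
intermediate point is a competitor at both ends. -/
theorem convexOn (h : IsSymmetricGap D l b ψ) : ConvexOn ℝ (Icc 0 1) ψ := by
  refine ⟨convex_Icc 0 1, fun x hx y hy s t hs ht hst => ?_⟩
  have hz := convex_Icc (0 : ℝ) 1 hx hy hs ht hst
  simp only [smul_eq_mul] at hz ⊢
  rw [h.eq_sub x hx, h.eq_sub y hy, h.eq_sub _ hz]
  simp only [h.condRisk_zero]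
  have h1 := mul_le_mul_of_nonneg_left
    (h.condRisk_minimizer_le x hx _ (h.minimizer_mem _ hz)) hs
  have h2 := mul_le_mul_of_nonneg_left
    (h.condRisk_minimizer_le y hy _ (h.minimizer_mem _ hz)) ht
  set c := b (s * x + t * y)
  have h3 : condRisk l ((1 + (s * x + t * y)) / 2) c
      = s * condRisk l ((1 + x) / 2) c + t * condRisk l ((1 + y) / 2) c := by
    obtain rfl : t = 1 - s := by linarith
    simp only [condRisk]
    ring
  have h4 : l 0 1 = s * l 0 1 + t * l 0 1 := by rw [← add_mul, hst, one_mul]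
  linarith

/-- Convexity and ψ 0 = 0 give ψ x ≤ (x / y) ψ y for x ≤ y, and ψ y ≥ 0 does the rest. -/
theorem monotoneOn (h : IsSymmetricGap D l b ψ) : MonotoneOn ψ (Icc 0 1) := by
  intro x hx y hy hxy
  rcases hy.1.eq_or_lt with h0 | h0
  · rw [le_antisymm hxy (h0 ▸ hx.1)]
  have h1 := h.convexOn.2 hy ⟨le_rfl, zero_le_one⟩ (div_nonneg hx.1 hy.1)
    (sub_nonneg.2 ((div_le_one h0).2 hxy)) (by ring)
  simp only [smul_eq_mul, mul_zero, add_zero, h.map_zero, div_mul_cancel₀ _ h0.ne'] at h1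
  exact h1.trans (mul_le_of_le_one_left (h.nonneg y hy) ((div_le_one h0).2 hxy))

/-- At z = 1 the conditional risk is the loss for the label +1 itself, so one value, at `b 1`,
controls all of them. -/
theorem loss_nonneg (h : IsSymmetricGap D l b ψ) (h1 : 0 ≤ l (b 1) 1) {a : ℝ} (ha : a ∈ D)
    (y : Label) : 0 ≤ l a (y : ℝ) := by
  have key : ∀ a ∈ D, 0 ≤ l a 1 := by
    intro a ha
    have := h.condRisk_minimizer_le 1 ⟨zero_le_one, le_rfl⟩ a ha
    norm_num [condRisk] at this
    exact h1.trans this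
  rcases y.eq_pos_or_eq_neg with rfl | rfl
  · exact key a ha
  · rw [Label.coe_neg, ← h.loss_neg a ha]
    exact key _ (h.neg_mem a ha)

theorem isLinkFunction (h : IsSymmetricGap D l b ψ) (h1 : 0 ≤ l (b 1) 1)
    (hl : ∀ y : Label, ContinuousOn (fun a => l a (y : ℝ)) D)
    (hψ : ContinuousOn ψ (Icc 0 1)) : IsLinkFunction X D l ψ := by
  refine isLinkFunction_of_condRisk_le
    -- For p < 1/2 the minimizer is the reflection of the one at 1 - p.
    (b := fun p => if 1 / 2 ≤ p then b (2 * p - 1) else -b (1 - 2 * p))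
    (fun a ha => h.loss_nonneg h1 ha) hl hψ h.nonneg h.monotoneOn h.convexOn h.map_zero ?_ ?_ ?_ ?_
  · refine Measurable.ite measurableSet_Ici ?_ ?_
    · exact h.measurable_minimizer.comp (by fun_prop)
    · exact (h.measurable_minimizer.comp (by fun_prop)).neg
  · intro p hp
    split_ifs with h2
    · exact h.minimizer_mem _ ⟨by linarith, by linarith [hp.2]⟩
    · exact h.neg_mem _ (h.minimizer_mem _ ⟨by linarith, by linarith [hp.1]⟩)
  · intro p hp a ha
    split_ifs with h2
    · have := h.condRisk_minimizer_le (2 * p - 1) ⟨by linarith, by linarith [hp.2]⟩ a ha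
      rwa [show (1 + (2 * p - 1)) / 2 = p by ring] at this
    · have hz : 1 - 2 * p ∈ Icc (0 : ℝ) 1 := ⟨by linarith, by linarith [hp.1]⟩
      have := h.condRisk_minimizer_le (1 - 2 * p) hz (-a) (h.neg_mem a ha)
      rw [show (1 + (1 - 2 * p)) / 2 = 1 - p by ring, h.condRisk_neg ha] at this
      rwa [← h.condRisk_neg (h.neg_mem _ (h.minimizer_mem _ hz)), neg_neg]
  · intro p hp a ha hap
    split_ifs with h2
    · have hz : 2 * p - 1 ∈ Icc (0 : ℝ) 1 := ⟨by linarith, by linarith [hp.2]⟩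
      rw [abs_of_nonneg hz.1, h.eq_sub _ hz, show (1 + (2 * p - 1)) / 2 = p by ring,
        add_sub_cancel]
      -- At p = 1/2 the sign condition is void, but there 0 = `b 0` is optimal among all
      -- predictions.
      rcases hz.1.eq_or_lt with h0 | h0
      · have h3 := h.condRisk_minimizer_le 0 ⟨le_rfl, zero_le_one⟩ a ha
        rwa [h.minimizer_zero, show (1 + (0 : ℝ)) / 2 = p by linarith] at h3
      · have h3 := h.condRisk_zero_le _ hz a ha (nonpos_of_mul_nonpos_left hap h0)
        rwa [show (1 + (2 * p - 1)) / 2 = p by ring] at h3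
    · have hz : 1 - 2 * p ∈ Icc (0 : ℝ) 1 := ⟨by linarith, by linarith [hp.1]⟩
      have h3 := h.condRisk_zero_le _ hz (-a) (h.neg_mem a ha) (by
        have : 0 ≤ a := by
          by_contra hneg
          have := mul_pos_of_neg_of_neg (not_le.1 hneg) (show 2 * p - 1 < 0 by linarith)
          linarith
        linarith)
      rw [show (1 + (1 - 2 * p)) / 2 = 1 - p by ring, h.condRisk_neg ha] at h3
      rw [abs_of_nonpos (by linarith), neg_sub, h.eq_sub _ hz,
        show (1 + (1 - 2 * p)) / 2 = 1 - p by ring,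
        ← h.condRisk_neg (h.neg_mem _ (h.minimizer_mem _ hz)), neg_neg, add_sub_cancel]
      exact h3

theorem psiTilde_eq (h : IsSymmetricGap D l b ψ) {z : ℝ} (hz : z ∈ Icc (0 : ℝ) 1) :
    psiTilde D l z = ψ z := by
  have hopt : optRisk D l ((1 + z) / 2) = condRisk l ((1 + z) / 2) (b z) := by
    have : Nonempty D := ⟨⟨0, h.zero_mem⟩⟩
    exact le_antisymm
      (ciInf_le (f := fun a : D => condRisk l ((1 + z) / 2) (a : ℝ))
        ⟨condRisk l ((1 + z) / 2) (b z), by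
          rintro _ ⟨a, rfl⟩
          exact h.condRisk_minimizer_le z hz a a.2⟩ ⟨b z, h.minimizer_mem z hz⟩)
      (le_ciInf fun a => h.condRisk_minimizer_le z hz a a.2)
  have hle (a : {a : ℝ // a ∈ D ∧ a * (2 * ((1 + z) / 2) - 1) ≤ 0}) :
      condRisk l ((1 + z) / 2) 0 ≤ condRisk l ((1 + z) / 2) (a : ℝ) := by
    rcases hz.1.eq_or_lt with rfl | h0
    · have := h.condRisk_minimizer_le 0 hz a a.2.1
      rwa [h.minimizer_zero] at this
    · refine h.condRisk_zero_le z hz a a.2.1 (nonpos_of_mul_nonpos_left a.2.2 ?_)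
      linarith
  have hmem : (0 : ℝ) ∈ D ∧ (0 : ℝ) * (2 * ((1 + z) / 2) - 1) ≤ 0 := ⟨h.zero_mem, by simp⟩
  have hminus : optRiskMinus D l ((1 + z) / 2) = condRisk l ((1 + z) / 2) 0 := by
    have : Nonempty {a : ℝ // a ∈ D ∧ a * (2 * ((1 + z) / 2) - 1) ≤ 0} := ⟨⟨0, hmem⟩⟩
    exact le_antisymm
      (ciInf_le (f := fun a : {a : ℝ // a ∈ D ∧ a * (2 * ((1 + z) / 2) - 1) ≤ 0} =>
          condRisk l ((1 + z) / 2) (a : ℝ))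
        ⟨condRisk l ((1 + z) / 2) 0, by
          rintro _ ⟨a, rfl⟩
          exact hle a⟩ ⟨0, hmem⟩)
      (le_ciInf hle)
  rw [psiTilde, hopt, hminus, h.eq_sub z hz]

/-- ψ̃ agrees with ψ, whose epigraph is already convex and closed, so the hull and the closure
change nothing. -/
theorem isPsiTransform (h : IsSymmetricGap D l b ψ) (hψ : ContinuousOn ψ (Icc 0 1)) :
    IsPsiTransform D l ψ := by
  have h1 : epi (psiTilde D l) = epi ψ := by
    ext w
    refine and_congr_right fun hw => ?_
    rw [h.psiTilde_eq hw]
  have h2 : Convex ℝ (epi ψ) := h.convexOn.convex_epigraph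
  have h3 : IsClosed (epi ψ) := isClosed_Icc.epigraph hψ
  rw [IsPsiTransform, h1, h2.convexHull_eq, h3.closure_eq]

end IsSymmetricGap

/-! ### Calculus -/

/-- A second order Taylor expansion at a critical zero. -/
theorem isLittleO_sub_sq_of_hasDerivAt {f f' : ℝ → ℝ} {c : ℝ} (h0 : f 0 = 0) (h0' : f' 0 = 0)
    (hf : ∀ᶠ z in 𝓝 0, HasDerivAt f (f' z) z) (hf' : HasDerivAt f' (2 * c) 0) :
    (fun z => f z - c * z ^ 2) =o[𝓝 0] fun z : ℝ => z ^ 2 := by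
  rw [Asymptotics.isLittleO_iff]
  intro ε hε
  have h1 := (hasDerivAt_iff_isLittleO.1 hf').def hε
  obtain ⟨δ, hδ, h⟩ := Metric.eventually_nhds_iff_ball.1 (hf.and h1)
  refine Metric.eventually_nhds_iff_ball.2 ⟨δ, hδ, fun z hz => ?_⟩
  have hsub : uIcc 0 z ⊆ Metric.ball 0 δ := by
    rw [← segment_eq_uIcc]
    exact (convex_ball (0 : ℝ) δ).segment_subset (Metric.mem_ball_self hδ) hz
  -- Mean value inequality for f - c z² between 0 and z, where its derivative is at most ε |z|.
  have key := (convex_uIcc (0 : ℝ) z).norm_image_sub_le_of_norm_hasDerivWithin_le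
    (f := fun z => f z - c * z ^ 2) (f' := fun z => f' z - c * (2 * z)) (C := ε * |z|)
    (x := 0) (y := z) ?_ ?_ left_mem_uIcc right_mem_uIcc
  · simp only [h0, sub_zero, ne_eq, OfNat.ofNat_ne_zero, not_false_eq_true, zero_pow,
      mul_zero, Real.norm_eq_abs] at key
    rw [Real.norm_eq_abs, Real.norm_eq_abs, abs_pow, sq |z|, ← mul_assoc]
    exact key
  · intro x hx
    have h2 := (h x (hsub hx)).1.sub (((hasDerivAt_id x).pow 2).const_mul c)
    refine (h2.congr_deriv ?_).hasDerivWithinAt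
    simp
  · intro x hx
    have h3 := (h x (hsub hx)).2
    have h4 : |x| ≤ |z| := by
      have := abs_sub_left_of_mem_uIcc hx
      simpa using this
    simp only [h0', sub_zero, smul_eq_mul, Real.norm_eq_abs] at h3 ⊢
    rw [show f' x - c * (2 * x) = f' x - x * (2 * c) by ring]
    exact h3.trans (mul_le_mul_of_nonneg_left h4 hε.le)

/-- Two differentiable functions with the same value and derivative at `c` can be glued. -/
theorem hasDerivAt_glue {f g h : ℝ → ℝ} {c d : ℝ} (hg : HasDerivAt g d c)
    (hh : HasDerivAt h d c) (hfg : ∀ᶠ x in 𝓝 c, x ≤ c → f x = g x)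
    (hfh : ∀ᶠ x in 𝓝 c, c ≤ x → f x = h x) : HasDerivAt f d c := by
  have h1 : HasDerivWithinAt f d (Iic c) c :=
    hg.hasDerivWithinAt.congr_of_eventuallyEq (eventually_nhdsWithin_iff.2 hfg)
      (hfg.self_of_nhds le_rfl)
  have h2 : HasDerivWithinAt f d (Ici c) c :=
    hh.hasDerivWithinAt.congr_of_eventuallyEq (eventually_nhdsWithin_iff.2 hfh)
      (hfh.self_of_nhds le_rfl)
  have h3 := h1.union h2
  rwa [Iic_union_Ici, hasDerivWithinAt_univ] at h3

/-- The function t log u - u of u is maximal at u = t; for t > 0 this is log x ≤ x - 1 at x = u / t.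
It identifies the minimizers for the least confidence and margin losses. -/
theorem mul_log_le {t u : ℝ} (ht : 0 ≤ t) (hu : 0 < u) :
    t * Real.log u ≤ t * Real.log t + u - t := by
  rcases ht.eq_or_lt with rfl | ht
  · simpa using hu.le
  have h1 := mul_le_mul_of_nonneg_left (Real.log_le_sub_one_of_pos (div_pos hu ht)) ht.le
  rw [Real.log_div hu.ne' ht.ne', mul_sub, mul_sub, mul_div_cancel₀ _ ht.ne'] at h1
  linarith

/-! ### Equivalent losses that are symmetric -/

/-- Reflection reduces the label -1 to the label +1: as U is even, the chain rule changes the sign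
of both derivatives alike. -/
theorem isEquivalentLoss_of_symmetric {D E : Set ℝ} {U : ℝ → ℝ} {l l' : ℝ → ℝ → ℝ}
    (hD : ∀ a ∈ D, -a ∈ D) (hE : ∀ a ∈ interior D \ E, -a ∈ interior D \ E)
    (hU : ∀ a, U (-a) = U a) (hl : ∀ a, l (-a) 1 = l a (-1)) (hl' : ∀ a, l' (-a) 1 = l' a (-1))
    (hc : ContinuousOn (fun a => l' a 1) D)
    (hd : ∀ a ∈ interior D \ E, ∃ d : ℝ, HasDerivAt (fun b => l b 1) d a ∧
      HasDerivAt (fun b => l' b 1) (U a * d) a) :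
    IsEquivalentLoss D E U l l' := by
  intro y
  rcases y.eq_pos_or_eq_neg with rfl | rfl
  · exact ⟨hc, hd⟩
  simp only [Label.coe_neg, ← hl, ← hl']
  refine ⟨hc.comp continuous_neg.continuousOn hD, fun a ha => ?_⟩
  obtain ⟨d, h1, h2⟩ := hd (-a) (hE a ha)
  refine ⟨-d, ?_, ?_⟩
  · exact (h1.comp a (hasDerivAt_neg a)).congr_deriv (by ring)
  · exact (h2.comp a (hasDerivAt_neg a)).congr_deriv (by rw [hU]; ring)

/-! ### Predicted probabilities and the cross-entropy loss -/

theorem prob_neg (a : ℝ) : prob (-a) = 1 - prob a := by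
  unfold prob
  ring

theorem one_sub_prob_neg (a : ℝ) : 1 - prob (-a) = prob a := by
  unfold prob
  ring

theorem crossEntropy_one (a : ℝ) : crossEntropy a 1 = -Real.log (prob a) := by
  norm_num [crossEntropy]

theorem crossEntropy_neg_one (a : ℝ) : crossEntropy a (-1) = -Real.log (1 - prob a) := by
  norm_num [crossEntropy]

theorem crossEntropy_neg (a : ℝ) : crossEntropy (-a) 1 = crossEntropy a (-1) := by
  rw [crossEntropy_one, crossEntropy_neg_one, prob_neg]

theorem hasDerivAt_prob (a : ℝ) : HasDerivAt prob (1 / 2) a :=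
  ((hasDerivAt_id a).const_add 1).div_const 2

theorem hasDerivAt_crossEntropy_one {a : ℝ} (ha : -1 < a) :
    HasDerivAt (fun b => crossEntropy b 1) (-(1 / (1 + a))) a := by
  simp only [crossEntropy_one]
  have h : prob a ≠ 0 := by
    unfold prob
    linarith
  refine ((hasDerivAt_prob a).log h).neg.congr_deriv ?_
  have : 1 + a ≠ 0 := by linarith
  unfold prob
  field_simp

theorem neg_mem_Icc_neg_one_one (a : ℝ) (ha : a ∈ Icc (-1 : ℝ) 1) : -a ∈ Icc (-1 : ℝ) 1 :=
  ⟨by linarith [ha.2], by linarith [ha.1]⟩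

theorem neg_mem_interior_Icc_neg_one_one (a : ℝ) (ha : a ∈ interior (Icc (-1 : ℝ) 1) \ ∅) :
    -a ∈ interior (Icc (-1 : ℝ) 1) \ ∅ := by
  rw [interior_Icc, sdiff_empty] at ha ⊢
  exact ⟨by linarith [ha.2], by linarith [ha.1]⟩

/-! ### Least confidence uncertainty -/

/-- This form without branches makes continuity at 0 evident. -/
theorem leastConfidenceLoss_one (a : ℝ) : leastConfidenceLoss a 1
    = Real.log 2 - Real.log (1 + max a 0) - (1 - |a|) / 2 := by
  unfold leastConfidenceLoss prob
  rcases lt_or_ge a 0 with h | h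
  · rw [if_pos (by linarith), max_eq_right h.le, abs_of_neg h]
    norm_num
    ring
  · rw [if_neg (by linarith), max_eq_left h, abs_of_nonneg h,
      show 2 * ((1 + a) / 2) = 1 + a by ring]
    norm_num
    ring

theorem leastConfidenceLoss_neg (a : ℝ) :
    leastConfidenceLoss (-a) 1 = leastConfidenceLoss a (-1) := by
  rw [leastConfidenceLoss_one, abs_neg]
  unfold leastConfidenceLoss prob
  rcases lt_or_ge a 0 with h | h
  · rw [if_pos (by linarith), max_eq_left (by linarith), abs_of_neg h,
      show 2 * (1 - (1 + a) / 2) = 1 + -a by ring]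
    norm_num
    ring
  · rw [if_neg (by linarith), max_eq_right (by linarith), abs_of_nonneg h]
    norm_num
    ring

theorem continuous_leastConfidenceLoss_one : Continuous fun a => leastConfidenceLoss a 1 := by
  simp only [leastConfidenceLoss_one]
  have : Continuous fun a : ℝ => Real.log (1 + max a 0) :=
    Continuous.log (by fun_prop) fun a => by
      have := le_max_right a 0
      positivity
  fun_prop

theorem leastConfidenceUncertainty_neg (a : ℝ) :
    leastConfidenceUncertainty (-a) = leastConfidenceUncertainty a := by
  rw [leastConfidenceUncertainty, leastConfidenceUncertainty, one_sub_prob_neg, prob_neg,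
    min_comm]

/-- At 0 both branches have the value log 2 - 1/2 and the slope -1/2, so no exceptional point is
needed. -/
theorem hasDerivAt_leastConfidenceLoss_one {a : ℝ} (ha : -1 < a) :
    HasDerivAt (fun b => leastConfidenceLoss b 1)
      (leastConfidenceUncertainty a * -(1 / (1 + a))) a := by
  have ha0 : 1 + a ≠ 0 := by linarith
  have hleft : HasDerivAt (fun b : ℝ => Real.log 2 - (1 + b) / 2) (-(1 / 2)) a :=
    (((hasDerivAt_id a).const_add 1).div_const 2).const_sub _
  have hright : HasDerivAt (fun b : ℝ => Real.log 2 - Real.log (1 + b) - (1 - b) / 2)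
      (1 / 2 - 1 / (1 + a)) a := by
    refine (((((hasDerivAt_id a).const_add 1).log ha0).const_sub (Real.log 2)).sub
      (((hasDerivAt_id a).const_sub 1).div_const 2)).congr_deriv ?_
    simp only [id]
    ring
  have hU : leastConfidenceUncertainty a = if a ≤ 0 then (1 + a) / 2 else (1 - a) / 2 := by
    unfold leastConfidenceUncertainty prob
    split_ifs with h
    · exact min_eq_left (by linarith)
    · rw [min_eq_right (by linarith)]
      ring
  have eleft (b : ℝ) (hb : b ≤ 0) : leastConfidenceLoss b 1 = Real.log 2 - (1 + b) / 2 := by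
    rw [leastConfidenceLoss_one, max_eq_right hb, abs_of_nonpos hb]
    norm_num
  have eright (b : ℝ) (hb : 0 ≤ b) :
      leastConfidenceLoss b 1 = Real.log 2 - Real.log (1 + b) - (1 - b) / 2 := by
    rw [leastConfidenceLoss_one, max_eq_left hb, abs_of_nonneg hb]
  rw [hU]
  rcases lt_trichotomy a 0 with h | rfl | h
  · rw [if_pos h.le]
    refine (hleft.congr_of_eventuallyEq ?_).congr_deriv (by field_simp)
    filter_upwards [Iio_mem_nhds h] with b hb using eleft b (le_of_lt hb)
  · rw [if_pos le_rfl]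
    exact hasDerivAt_glue (hleft.congr_deriv (by norm_num)) (hright.congr_deriv (by norm_num))
      (Eventually.of_forall eleft) (Eventually.of_forall eright)
  · rw [if_neg h.not_ge]
    refine (hright.congr_of_eventuallyEq ?_).congr_deriv (by field_simp; ring)
    filter_upwards [Ioi_mem_nhds h] with b hb using eright b (le_of_lt hb)

theorem isEquivalentLoss_leastConfidenceLoss : IsEquivalentLoss (Icc (-1) 1) ∅
    leastConfidenceUncertainty crossEntropy leastConfidenceLoss := by
  refine isEquivalentLoss_of_symmetric neg_mem_Icc_neg_one_one neg_mem_interior_Icc_neg_one_one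
    leastConfidenceUncertainty_neg crossEntropy_neg leastConfidenceLoss_neg
    continuous_leastConfidenceLoss_one.continuousOn fun a ha => ?_
  rw [interior_Icc, sdiff_empty] at ha
  exact ⟨_, hasDerivAt_crossEntropy_one ha.1, hasDerivAt_leastConfidenceLoss_one ha.1⟩

theorem condRisk_leastConfidenceLoss_of_nonneg (p : ℝ) {a : ℝ} (ha : 0 ≤ a) :
    condRisk leastConfidenceLoss p a
      = Real.log 2 - p * Real.log (1 + a) - (1 - a) / 2 := by
  rw [condRisk, ← leastConfidenceLoss_neg, leastConfidenceLoss_one, leastConfidenceLoss_one,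
    abs_neg, abs_of_nonneg ha, max_eq_left ha, max_eq_right (by linarith)]
  norm_num
  ring

theorem condRisk_leastConfidenceLoss_of_nonpos (p : ℝ) {a : ℝ} (ha : a ≤ 0) :
    condRisk leastConfidenceLoss p a
      = Real.log 2 - (1 - p) * Real.log (1 - a) - (1 + a) / 2 := by
  rw [condRisk, ← leastConfidenceLoss_neg, leastConfidenceLoss_one, leastConfidenceLoss_one,
    abs_neg, abs_of_nonpos ha, max_eq_right ha, max_eq_left (by linarith), ← sub_eq_add_neg]
  norm_num
  ring

theorem isSymmetricGap_leastConfidence :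
    IsSymmetricGap (Icc (-1) 1) leastConfidenceLoss id leastConfidenceLink := by
  have hpos (z : ℝ) (hz : z ∈ Icc (0 : ℝ) 1) (a : ℝ) (ha : 0 ≤ a) :
      condRisk leastConfidenceLoss ((1 + z) / 2) z
        ≤ condRisk leastConfidenceLoss ((1 + z) / 2) a := by
    rw [condRisk_leastConfidenceLoss_of_nonneg _ hz.1, condRisk_leastConfidenceLoss_of_nonneg _ ha]
    have := mul_log_le (t := 1 + z) (u := 1 + a) (by linarith [hz.1]) (by linarith)
    linarith
  have hneg (z : ℝ) (hz : z ∈ Icc (0 : ℝ) 1) (a : ℝ) (ha : a ≤ 0) :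
      condRisk leastConfidenceLoss ((1 + z) / 2) 0
        ≤ condRisk leastConfidenceLoss ((1 + z) / 2) a := by
    rw [condRisk_leastConfidenceLoss_of_nonneg _ le_rfl,
      condRisk_leastConfidenceLoss_of_nonpos _ ha]
    -- The claim amounts to (1 - z) log(1 - a) ≤ -a, which follows from log(1 - a) ≤ -a and 0 ≤ z ≤
    -- 1.
    have h1 := Real.log_le_sub_one_of_pos (show 0 < 1 - a by linarith)
    have h2 := mul_le_mul_of_nonneg_left h1 (show 0 ≤ 1 - (1 + z) / 2 by linarith [hz.2])
    have h3 := mul_nonneg hz.1 (show 0 ≤ -a by linarith)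
    norm_num
    nlinarith
  refine ⟨neg_mem_Icc_neg_one_one, by norm_num, fun z hz => ⟨by simp; linarith [hz.1], hz.2⟩,
    measurable_id, fun a _ => leastConfidenceLoss_neg a, rfl, fun z hz a _ => ?_,
    fun z hz a _ ha => hneg z hz a ha, fun z hz => ?_⟩
  · rcases le_total 0 a with ha | ha
    · exact hpos z hz a ha
    · exact (hpos z hz 0 le_rfl).trans (hneg z hz a ha)
  · rw [id, condRisk_leastConfidenceLoss_of_nonneg _ le_rfl,
      condRisk_leastConfidenceLoss_of_nonneg _ hz.1, leastConfidenceLink]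
    norm_num
    ring

theorem hasDerivAt_leastConfidenceLink {z : ℝ} (hz : -1 < z) :
    HasDerivAt leastConfidenceLink (Real.log (1 + z) / 2) z := by
  have h0 : 1 + z ≠ 0 := by linarith
  have h1 := (hasDerivAt_id z).const_add 1
  refine (((h1.div_const 2).mul (h1.log h0)).sub ((hasDerivAt_id z).div_const 2)).congr_deriv ?_
  simp only [id]
  field_simp
  ring

theorem continuousOn_leastConfidenceLink : ContinuousOn leastConfidenceLink (Icc 0 1) :=
  fun z hz => (hasDerivAt_leastConfidenceLink (by linarith [hz.1])).continuousAt.continuousWithinAt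

theorem leastConfidenceLink_isLittleO :
    (fun z => leastConfidenceLink z - 1 / 4 * z ^ 2) =o[𝓝 0] fun z : ℝ => z ^ 2 := by
  refine isLittleO_sub_sq_of_hasDerivAt (f' := fun z => Real.log (1 + z) / 2)
    isSymmetricGap_leastConfidence.map_zero (by simp) ?_ ?_
  · filter_upwards [Ioi_mem_nhds (show (-1 : ℝ) < 0 by norm_num)] with z hz
      using hasDerivAt_leastConfidenceLink hz
  · refine ((((hasDerivAt_id (0 : ℝ)).const_add 1).log (by norm_num)).div_const 2).congr_deriv ?_
    norm_num

theorem isLinkFunction_leastConfidence (X : Type*) [MeasurableSpace X] :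
    IsLinkFunction X (Icc (-1) 1) leastConfidenceLoss leastConfidenceLink :=
  isSymmetricGap_leastConfidence.isLinkFunction
    -- The loss vanishes at the prediction 1 with label +1.
    (by rw [id, leastConfidenceLoss_one]; norm_num)
    (fun y => (isEquivalentLoss_leastConfidenceLoss y).1) continuousOn_leastConfidenceLink

/-! ### Margin-based uncertainty -/

/-- The value of the margin loss at the prediction `0`. -/
noncomputable def marginConst (μ : ℝ) : ℝ :=
  2 / μ * (1 / μ + 1) * Real.log (1 + μ) - 2 / μ

theorem marginLoss_neg (μ a : ℝ) : marginLoss μ (-a) 1 = marginLoss μ a (-1) := by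
  simp only [marginLoss, one_mul, neg_mul]

theorem marginLoss_one_of_nonpos (μ : ℝ) {s : ℝ} (hs : s ≤ 0) : marginLoss μ s 1
    = -(2 / μ) * (1 / μ - 1) * Real.log (1 - μ * s) - 2 / μ * s + marginConst μ := by
  simp only [marginLoss, one_mul, if_pos hs, marginConst]

theorem marginLoss_one_of_mem_Icc {μ : ℝ} {s : ℝ} (h0 : 0 ≤ s) (h1 : s ≤ 1) :
    marginLoss μ s 1
      = -(2 / μ) * (1 / μ + 1) * Real.log (1 + μ * s) + 2 / μ * s + marginConst μ := by
  simp only [marginLoss, one_mul, marginConst]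
  split_ifs with h h'
  · obtain rfl : s = 0 := le_antisymm h h0
    simp
  · rfl
  -- The constant is chosen so that the middle branch vanishes at s = 1.
  · obtain rfl : s = 1 := le_antisymm h1 (not_lt.1 h')
    ring_nf

theorem marginLoss_one_of_one_le (μ : ℝ) {s : ℝ} (hs : 1 ≤ s) : marginLoss μ s 1 = 0 := by
  simp only [marginLoss, one_mul]
  rw [if_neg (by linarith), if_neg (by linarith)]

/-- The branches match in value and slope at both junctions: the slope is -2 at 0 and 0 at 1. -/
theorem hasDerivAt_marginLoss_one {μ : ℝ} (hμ : 0 < μ) (s : ℝ) :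
    HasDerivAt (fun b => marginLoss μ b 1)
      (marginUncertainty μ s * (-2 * max 0 (1 - s))) s := by
  have hleft (hs : s ≤ 0) : HasDerivAt (fun s => -(2 / μ) * (1 / μ - 1) * Real.log (1 - μ * s)
      - 2 / μ * s + marginConst μ) (marginUncertainty μ s * (-2 * max 0 (1 - s))) s := by
    have h0 : 0 < 1 - μ * s := by nlinarith
    have h1 := (((hasDerivAt_id s).const_mul μ).const_sub 1).log h0.ne'
    refine (((h1.const_mul (-(2 / μ) * (1 / μ - 1))).sub
      ((hasDerivAt_id s).const_mul (2 / μ))).add_const (marginConst μ)).congr_deriv ?_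
    rw [marginUncertainty, abs_of_nonpos hs, max_eq_right (by linarith)]
    have h0' : 1 + μ * -s ≠ 0 := by linarith
    have h0'' := h0.ne'
    simp only [id]
    rw [show 1 + μ * -s = 1 - μ * s by ring]
    field_simp
    ring
  have hmid (hs : 0 ≤ s) (hs' : s ≤ 1) :
      HasDerivAt (fun s => -(2 / μ) * (1 / μ + 1) * Real.log (1 + μ * s)
      + 2 / μ * s + marginConst μ) (marginUncertainty μ s * (-2 * max 0 (1 - s))) s := by
    have h0 : 0 < 1 + μ * s := by positivity
    have h1 := (((hasDerivAt_id s).const_mul μ).const_add 1).log h0.ne'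
    refine (((h1.const_mul (-(2 / μ) * (1 / μ + 1))).add
      ((hasDerivAt_id s).const_mul (2 / μ))).add_const (marginConst μ)).congr_deriv ?_
    rw [marginUncertainty, abs_of_nonneg hs, max_eq_right (by linarith)]
    simp only [id]
    field_simp
    ring
  have hright (hs : 1 ≤ s) : HasDerivAt (fun _ : ℝ => (0 : ℝ))
      (marginUncertainty μ s * (-2 * max 0 (1 - s))) s :=
    (hasDerivAt_const s (0 : ℝ)).congr_deriv (by rw [max_eq_left (by linarith)]; ring)
  rcases le_or_gt s 0 with h | h
  · rcases h.eq_or_lt with h' | h'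
    · refine hasDerivAt_glue (hleft h) (hmid h'.ge (by linarith))
        (Eventually.of_forall fun x hx => marginLoss_one_of_nonpos μ (hx.trans h)) ?_
      filter_upwards [Iio_mem_nhds (show s < 1 by linarith)] with x hx hx'
        using marginLoss_one_of_mem_Icc (h'.ge.trans hx') (le_of_lt hx)
    · refine (hleft h).congr_of_eventuallyEq ?_
      filter_upwards [Iio_mem_nhds h'] with x hx using marginLoss_one_of_nonpos μ (le_of_lt hx)
  rcases lt_trichotomy s 1 with h1 | h1 | h1
  · refine (hmid h.le h1.le).congr_of_eventuallyEq ?_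
    filter_upwards [Ioo_mem_nhds h h1] with x hx
      using marginLoss_one_of_mem_Icc hx.1.le hx.2.le
  · refine hasDerivAt_glue (hmid h.le h1.le) (hright h1.ge) ?_
      (Eventually.of_forall fun x hx => marginLoss_one_of_one_le μ (h1.ge.trans hx))
    filter_upwards [Ioi_mem_nhds h] with x hx hx'
      using marginLoss_one_of_mem_Icc (le_of_lt hx) (hx'.trans h1.le)
  · refine (hright h1.le).congr_of_eventuallyEq ?_
    filter_upwards [Ioi_mem_nhds h1] with x hx using marginLoss_one_of_one_le μ (le_of_lt hx)

theorem hasDerivAt_squaredHinge_one (s : ℝ) :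
    HasDerivAt (fun b => squaredHinge b 1) (-2 * max 0 (1 - s)) s := by
  simp only [squaredHinge, one_mul]
  have hleft (hs : s ≤ 1) : HasDerivAt (fun b : ℝ => (1 - b) ^ 2) (-2 * max 0 (1 - s)) s := by
    refine (((hasDerivAt_id s).const_sub 1).pow 2).congr_deriv ?_
    rw [max_eq_right (by linarith)]
    simp
  have hright (hs : 1 ≤ s) : HasDerivAt (fun _ : ℝ => (0 : ℝ)) (-2 * max 0 (1 - s)) s :=
    (hasDerivAt_const s (0 : ℝ)).congr_deriv (by rw [max_eq_left (by linarith)]; ring)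
  have eleft (b : ℝ) (hb : b ≤ 1) : max 0 (1 - b) ^ 2 = (1 - b) ^ 2 := by
    rw [max_eq_right (by linarith)]
  have eright (b : ℝ) (hb : 1 ≤ b) : max 0 (1 - b) ^ 2 = 0 := by
    rw [max_eq_left (by linarith)]
    norm_num
  rcases lt_trichotomy s 1 with h | h | h
  · refine (hleft h.le).congr_of_eventuallyEq ?_
    filter_upwards [Iio_mem_nhds h] with x hx using eleft x (le_of_lt hx)
  · exact hasDerivAt_glue (hleft h.le) (hright h.ge)
      (Eventually.of_forall fun x hx => eleft x (hx.trans h.le))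
      (Eventually.of_forall fun x hx => eright x (h.ge.trans hx))
  · refine (hright h.le).congr_of_eventuallyEq ?_
    filter_upwards [Ioi_mem_nhds h] with x hx using eright x (le_of_lt hx)

theorem isEquivalentLoss_marginLoss {μ : ℝ} (hμ : 0 < μ) :
    IsEquivalentLoss univ ∅ (marginUncertainty μ) squaredHinge (marginLoss μ) :=
  isEquivalentLoss_of_symmetric (fun _ _ => mem_univ _) (fun a _ => by simp)
    (fun a => by rw [marginUncertainty, marginUncertainty, abs_neg])
    (fun a => by simp [squaredHinge]) (marginLoss_neg μ)
    (fun a _ => (hasDerivAt_marginLoss_one hμ a).continuousAt.continuousWithinAt)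
    fun a _ => ⟨_, hasDerivAt_squaredHinge_one a, hasDerivAt_marginLoss_one hμ a⟩

theorem antitone_marginLoss_one {μ : ℝ} (hμ : 0 < μ) : Antitone fun a => marginLoss μ a 1 := by
  refine antitone_of_deriv_nonpos
    (fun a => (hasDerivAt_marginLoss_one hμ a).differentiableAt) fun a => ?_
  rw [(hasDerivAt_marginLoss_one hμ a).deriv]
  have h1 : 0 ≤ marginUncertainty μ a := by
    unfold marginUncertainty
    positivity
  exact mul_nonpos_of_nonneg_of_nonpos h1 (by linarith [le_max_left 0 (1 - a)])

/-- The coefficients 1/μ + 1 and 1/μ - 1, weighted by p and 1 - p, add up to (1 + μz)/μ, leaving a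
single logarithm. -/
theorem condRisk_marginLoss_of_nonneg {μ : ℝ} (hμ : 0 < μ) (z : ℝ) {a : ℝ} (h0 : 0 ≤ a)
    (h1 : a ≤ 1) : condRisk (marginLoss μ) ((1 + z) / 2) a
      = marginConst μ - 2 / μ ^ 2 * ((1 + μ * z) * Real.log (1 + μ * a) - μ * a) := by
  rw [condRisk, ← marginLoss_neg, marginLoss_one_of_mem_Icc h0 h1,
    marginLoss_one_of_nonpos μ (neg_nonpos.2 h0), show 1 - μ * -a = 1 + μ * a by ring]
  field_simp
  ring

theorem condRisk_marginLoss_of_nonpos {μ : ℝ} (hμ : 0 < μ) (z : ℝ) {a : ℝ} (h0 : a ≤ 0)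
    (h1 : -1 ≤ a) : condRisk (marginLoss μ) ((1 + z) / 2) a
      = marginConst μ - 2 / μ ^ 2 * ((1 - μ * z) * Real.log (1 - μ * a) + μ * a) := by
  rw [condRisk, ← marginLoss_neg, marginLoss_one_of_nonpos μ h0,
    marginLoss_one_of_mem_Icc (neg_nonneg.2 h0) (by linarith), show 1 + μ * -a = 1 - μ * a by ring]
  field_simp
  ring

theorem isSymmetricGap_margin {μ : ℝ} (hμ : 0 < μ) :
    IsSymmetricGap univ (marginLoss μ) id (marginLink μ) := by
  have hμ2 : 0 ≤ 2 / μ ^ 2 := by positivity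
  have hanti := antitone_marginLoss_one hμ
  have hmid (z : ℝ) (hz : z ∈ Icc (0 : ℝ) 1) (a : ℝ) (h0 : 0 ≤ a) (h1 : a ≤ 1) :
      condRisk (marginLoss μ) ((1 + z) / 2) z ≤ condRisk (marginLoss μ) ((1 + z) / 2) a := by
    rw [condRisk_marginLoss_of_nonneg hμ z hz.1 hz.2, condRisk_marginLoss_of_nonneg hμ z h0 h1]
    refine sub_le_sub_left (mul_le_mul_of_nonneg_left ?_ hμ2) _
    have hz1 := mul_nonneg hμ.le hz.1
    have ha1 := mul_nonneg hμ.le h0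
    have := mul_log_le (t := 1 + μ * z) (u := 1 + μ * a) (by linarith) (by linarith)
    linarith
  have hpos (z : ℝ) (hz : z ∈ Icc (0 : ℝ) 1) (a : ℝ) (h0 : 0 ≤ a) :
      condRisk (marginLoss μ) ((1 + z) / 2) z ≤ condRisk (marginLoss μ) ((1 + z) / 2) a := by
    rcases le_total a 1 with h1 | h1
    · exact hmid z hz a h0 h1
    -- Beyond 1 the loss for the label +1 stays 0 while that for -1 does not decrease, so 1 is no
    -- worse.
    · refine (hmid z hz 1 zero_le_one le_rfl).trans ?_
      rw [condRisk, condRisk, marginLoss_one_of_one_le μ le_rfl, marginLoss_one_of_one_le μ h1,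
        ← marginLoss_neg, ← marginLoss_neg]
      exact add_le_add le_rfl (mul_le_mul_of_nonneg_left (hanti (by linarith))
        (by linarith [hz.2]))
  have hneg' (z : ℝ) (hz : z ∈ Icc (0 : ℝ) 1) (a : ℝ) (h0 : a ≤ 0) (h1 : -1 ≤ a) :
      condRisk (marginLoss μ) ((1 + z) / 2) 0 ≤ condRisk (marginLoss μ) ((1 + z) / 2) a := by
    rw [condRisk_marginLoss_of_nonneg hμ z le_rfl zero_le_one,
      condRisk_marginLoss_of_nonpos hμ z h0 h1]
    refine sub_le_sub_left (mul_le_mul_of_nonneg_left ?_ hμ2) _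
    have ha1 := mul_nonneg hμ.le (neg_nonneg.2 h0)
    -- Since 1 - μz may be negative, the term -μz log(1 - μa) ≤ 0 is dropped separately.
    have hlog := Real.log_le_sub_one_of_pos (show 0 < 1 - μ * a by linarith)
    have hlog' := Real.log_nonneg (show 1 ≤ 1 - μ * a by linarith)
    have := mul_nonneg (mul_nonneg hμ.le hz.1) hlog'
    norm_num
    linarith
  have hneg (z : ℝ) (hz : z ∈ Icc (0 : ℝ) 1) (a : ℝ) (h0 : a ≤ 0) :
      condRisk (marginLoss μ) ((1 + z) / 2) 0 ≤ condRisk (marginLoss μ) ((1 + z) / 2) a := by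
    rcases le_total (-1) a with h1 | h1
    · exact hneg' z hz a h0 h1
    · refine (hneg' z hz (-1) (by norm_num) le_rfl).trans ?_
      rw [condRisk, condRisk, ← marginLoss_neg, ← marginLoss_neg,
        marginLoss_one_of_one_le μ (show (1 : ℝ) ≤ - -1 by norm_num),
        marginLoss_one_of_one_le μ (show 1 ≤ -a by linarith)]
      exact add_le_add (mul_le_mul_of_nonneg_left (hanti h1) (by linarith [hz.1])) le_rfl
  refine ⟨fun _ _ => mem_univ _, mem_univ _, fun _ _ => mem_univ _, measurable_id,
    fun a _ => marginLoss_neg μ a, rfl, fun z hz a _ => ?_,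
    fun z hz a _ ha => hneg z hz a ha, fun z hz => ?_⟩
  · rcases le_total 0 a with ha | ha
    · exact hpos z hz a ha
    · exact (hpos z hz 0 le_rfl).trans (hneg z hz a ha)
  · rw [id, condRisk_marginLoss_of_nonneg hμ z le_rfl zero_le_one,
      condRisk_marginLoss_of_nonneg hμ z hz.1 hz.2, marginLink]
    simp only [mul_zero, add_zero, Real.log_one, sub_zero]
    field_simp
    ring

theorem hasDerivAt_marginLink {μ z : ℝ} (hμ : 0 < μ) (hz : 0 < 1 + μ * z) :
    HasDerivAt (marginLink μ) (2 / μ * Real.log (1 + μ * z)) z := by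
  have h1 := ((hasDerivAt_id z).const_mul μ).const_add 1
  refine (((h1.const_mul (2 / μ ^ 2)).mul (h1.log hz.ne')).sub
    ((hasDerivAt_id z).const_mul (2 / μ))).congr_deriv ?_
  simp only [id]
  field_simp
  ring

theorem continuousOn_marginLink {μ : ℝ} (hμ : 0 < μ) : ContinuousOn (marginLink μ) (Icc 0 1) :=
  fun z hz => (hasDerivAt_marginLink hμ (by nlinarith [hz.1])).continuousAt.continuousWithinAt

theorem marginLink_isLittleO {μ : ℝ} (hμ : 0 < μ) :
    (fun z => marginLink μ z - z ^ 2) =o[𝓝 0] fun z : ℝ => z ^ 2 := by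
  have hev : ∀ᶠ z : ℝ in 𝓝 0, 0 < 1 + μ * z :=
    (show ContinuousAt (fun z : ℝ => 1 + μ * z) 0 by fun_prop).eventually
      (lt_mem_nhds (by norm_num))
  have := isLittleO_sub_sq_of_hasDerivAt (c := 1) (f' := fun z => 2 / μ * Real.log (1 + μ * z))
    (isSymmetricGap_margin hμ).map_zero (by simp)
    (hev.mono fun z hz => hasDerivAt_marginLink hμ hz) (by
      refine (((((hasDerivAt_id (0 : ℝ)).const_mul μ).const_add 1).log
        (by simp)).const_mul (2 / μ)).congr_deriv ?_
      simp
      field_simp)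
  simpa only [one_mul] using this

theorem isLinkFunction_margin (X : Type*) [MeasurableSpace X] {μ : ℝ} (hμ : 0 < μ) :
    IsLinkFunction X univ (marginLoss μ) (marginLink μ) :=
  (isSymmetricGap_margin hμ).isLinkFunction (marginLoss_one_of_one_le μ le_rfl).ge
    (fun y => (isEquivalentLoss_marginLoss hμ y).1) (continuousOn_marginLink hμ)

/-! ### Threshold-based uncertainty -/

/-- The graph of `log (1 + exp a)` lies strictly above its tangents. -/
theorem log_one_add_exp_tangent_lt {a b : ℝ} (hab : a ≠ b) :
    Real.log (1 + Real.exp b) + Real.exp b / (1 + Real.exp b) * (a - b)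
      < Real.log (1 + Real.exp a) := by
  have hb := Real.exp_pos b
  have ha := Real.exp_pos a
  -- Convexity of exp at 0 and a - b, with weights 1/(1+eᵇ) and eᵇ/(1+eᵇ); taking logarithms gives
  -- the tangent bound.
  have h1 := strictConvexOn_exp.2 (mem_univ 0) (mem_univ (a - b)) (sub_ne_zero.2 hab).symm
    (show 0 < 1 / (1 + Real.exp b) by positivity)
    (show 0 < Real.exp b / (1 + Real.exp b) by positivity) (by field_simp)
  simp only [smul_eq_mul, mul_zero, zero_add, Real.exp_zero, mul_one] at h1
  have h2 : 1 / (1 + Real.exp b) + Real.exp b / (1 + Real.exp b) * Real.exp (a - b)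
      = (1 + Real.exp a) / (1 + Real.exp b) := by
    rw [Real.exp_sub]
    field_simp
  rw [h2, ← Real.lt_log_iff_exp_lt (by positivity),
    Real.log_div (by positivity) (by positivity)] at h1
  linarith

theorem log_one_add_exp_tangent_le (a b : ℝ) :
    Real.log (1 + Real.exp b) + Real.exp b / (1 + Real.exp b) * (a - b)
      ≤ Real.log (1 + Real.exp a) := by
  rcases eq_or_ne a b with rfl | h
  · simp
  · exact (log_one_add_exp_tangent_lt h).le

theorem log_one_add_exp_neg (a : ℝ) :
    Real.log (1 + Real.exp (-a)) = Real.log (1 + Real.exp a) - a := by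
  have ha := Real.exp_pos a
  rw [show 1 + Real.exp (-a) = (1 + Real.exp a) / Real.exp a by
    rw [Real.exp_neg]; field_simp; ring, Real.log_div (by positivity) (by positivity),
    Real.log_exp]

/-- The projection of `a` to `[-γ, γ]`. -/
noncomputable def clip (γ a : ℝ) : ℝ := max (-γ) (min γ a)

theorem clip_of_mem {γ a : ℝ} (h : a ∈ Icc (-γ) γ) : clip γ a = a := by
  rw [clip, min_eq_right h.2, max_eq_right h.1]

theorem clip_le {γ : ℝ} (hγ : 0 < γ) (a : ℝ) : clip γ a ≤ γ :=
  max_le (by linarith) (min_le_left _ _)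

theorem clip_nonpos {γ a : ℝ} (hγ : 0 < γ) (ha : a ≤ 0) : clip γ a ≤ 0 :=
  max_le (by linarith) ((min_le_right _ _).trans ha)

theorem clip_neg {γ : ℝ} (hγ : 0 < γ) (a : ℝ) : clip γ (-a) = -clip γ a := by
  unfold clip
  rcases le_total a (-γ) with h | h
  · rw [min_eq_left (by linarith), min_eq_right (by linarith), max_eq_right (by linarith),
      max_eq_left h, neg_neg]
  · rcases le_total a γ with h' | h'
    · rw [min_eq_right (by linarith), min_eq_right h', max_eq_right (by linarith),
        max_eq_right h]
    · rw [min_eq_right (by linarith), min_eq_left h', max_eq_left (by linarith),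
        max_eq_right (by linarith)]

/-- Zero uncertainty outside [-γ, γ] freezes the loss there, so minimizing its risk becomes a convex
problem on [-γ, γ]. -/
theorem thresholdLoss_one {γ : ℝ} (hγ : 0 < γ) (a : ℝ) :
    thresholdLoss γ a 1 = Real.log (1 + Real.exp (-clip γ a)) := by
  simp only [thresholdLoss, one_mul]
  split_ifs with h h'
  · rw [clip, min_eq_right (by linarith), max_eq_left h, neg_neg]
  · rw [clip_of_mem ⟨(not_le.1 h).le, h'.le⟩]
  · rw [clip, min_eq_left (not_lt.1 h'), max_eq_right (by linarith)]

theorem thresholdLoss_neg (γ a : ℝ) : thresholdLoss γ (-a) 1 = thresholdLoss γ a (-1) := by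
  simp only [thresholdLoss, one_mul, neg_mul]

theorem thresholdLoss_one_pos {γ : ℝ} (hγ : 0 < γ) (a : ℝ) : 0 < thresholdLoss γ a 1 := by
  rw [thresholdLoss_one hγ]
  exact Real.log_pos (by linarith [Real.exp_pos (-clip γ a)])

theorem continuous_thresholdLoss_one {γ : ℝ} (hγ : 0 < γ) :
    Continuous fun a => thresholdLoss γ a 1 := by
  simp only [thresholdLoss_one hγ, clip]
  exact Continuous.log (by fun_prop) fun a => by positivity

theorem condRisk_thresholdLoss {γ : ℝ} (hγ : 0 < γ) (p a : ℝ) :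
    condRisk (thresholdLoss γ) p a = Real.log (1 + Real.exp (clip γ a)) - p * clip γ a := by
  rw [condRisk, ← thresholdLoss_neg, thresholdLoss_one hγ, thresholdLoss_one hγ, clip_neg hγ,
    neg_neg, log_one_add_exp_neg]
  ring

theorem hasDerivAt_logisticLoss_one (a : ℝ) : HasDerivAt (fun b => logisticLoss b 1)
    (-Real.exp (-a) / (1 + Real.exp (-a))) a := by
  simp only [logisticLoss, one_mul]
  exact (((hasDerivAt_neg a).exp.const_add 1).log (by positivity)).congr_deriv (by ring)

/-- At ±γ the slope jumps between the nonzero logistic slope and 0, hence the exceptional set. -/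
theorem isEquivalentLoss_thresholdLoss {γ : ℝ} (hγ : 0 < γ) :
    IsEquivalentLoss univ {-γ, γ} (thresholdUncertainty γ) logisticLoss (thresholdLoss γ) := by
  refine isEquivalentLoss_of_symmetric (fun _ _ => mem_univ _) (fun a ha => ?_)
    (fun a => by simp only [thresholdUncertainty, abs_neg]) (fun a => by simp [logisticLoss])
    (thresholdLoss_neg γ) (continuous_thresholdLoss_one hγ).continuousOn
    fun a ha => ⟨_, hasDerivAt_logisticLoss_one a, ?_⟩
  · simp only [interior_univ, Set.mem_sdiff, mem_univ, true_and, mem_insert_iff,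
      mem_singleton_iff, not_or, neg_inj] at ha ⊢
    exact ⟨ha.2, fun h => ha.1 (by linarith)⟩
  · simp only [interior_univ, Set.mem_sdiff, mem_univ, true_and, mem_insert_iff,
      mem_singleton_iff, not_or] at ha
    rcases lt_or_gt_of_ne ha.1 with h | h
    · have h1 : ¬|a| ≤ γ := fun h' => by linarith [(abs_le.1 h').1]
      rw [thresholdUncertainty, if_neg h1, zero_mul]
      refine (hasDerivAt_const a (Real.log (1 + Real.exp γ))).congr_of_eventuallyEq ?_
      filter_upwards [Iio_mem_nhds h] with x hx
      rw [thresholdLoss, one_mul, if_pos (le_of_lt hx)]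
    rcases lt_or_gt_of_ne ha.2 with h' | h'
    · rw [thresholdUncertainty, if_pos (abs_le.2 ⟨le_of_lt h, h'.le⟩), one_mul]
      refine (hasDerivAt_logisticLoss_one a).congr_of_eventuallyEq ?_
      filter_upwards [Ioo_mem_nhds h h'] with x hx
      rw [thresholdLoss, one_mul, if_neg (not_le.2 hx.1), if_pos hx.2, logisticLoss, one_mul]
    · have h1 : ¬|a| ≤ γ := fun h'' => by linarith [(abs_le.1 h'').2]
      rw [thresholdUncertainty, if_neg h1, zero_mul]
      refine (hasDerivAt_const a (Real.log (1 + Real.exp (-γ)))).congr_of_eventuallyEq ?_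
      filter_upwards [Ioi_mem_nhds h'] with x hx
      have hx' : γ < x := hx
      rw [thresholdLoss, one_mul, if_neg (by linarith), if_neg (by linarith)]

/-! ### Where the logistic minimizer reaches the threshold -/

theorem tanh_half_eq (γ : ℝ) :
    Real.tanh (γ / 2) = (Real.exp γ - 1) / (Real.exp γ + 1) := by
  have h : Real.exp γ = Real.exp (γ / 2) * Real.exp (γ / 2) := by
    rw [← Real.exp_add, add_halves]
  have h0 := Real.exp_pos (γ / 2)
  rw [Real.tanh_eq, h, Real.exp_neg]
  field_simp

/-- At z = tanh(γ/2) the probability (1 + z)/2 is the sigmoid of γ, so log((1 + z)/(1 - z)) = γ. -/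
theorem one_add_tanh_half (γ : ℝ) :
    1 + Real.tanh (γ / 2) = 2 * Real.exp γ / (1 + Real.exp γ) := by
  have h0 := Real.exp_pos γ
  rw [tanh_half_eq, add_comm (Real.exp γ)]
  field_simp
  ring

theorem one_sub_tanh_half (γ : ℝ) : 1 - Real.tanh (γ / 2) = 2 / (1 + Real.exp γ) := by
  have h0 := Real.exp_pos γ
  rw [tanh_half_eq, add_comm (Real.exp γ)]
  field_simp
  ring

theorem tanh_half_mem_Ioo {γ : ℝ} (hγ : 0 < γ) : Real.tanh (γ / 2) ∈ Ioo (0 : ℝ) 1 := by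
  have h1 := Real.one_lt_exp_iff.2 hγ
  refine ⟨?_, ?_⟩
  · rw [tanh_half_eq]
    exact div_pos (by linarith) (by linarith)
  · have : 0 < 1 - Real.tanh (γ / 2) := by
      rw [one_sub_tanh_half]
      positivity
    linarith

/-- The minimizer of the conditional risk of the threshold loss at `p = (1 + z) / 2`. -/
noncomputable def thresholdMinimizer (γ z : ℝ) : ℝ :=
  if z ≤ Real.tanh (γ / 2) then Real.log ((1 + z) / (1 - z)) else γ

theorem thresholdMinimizer_mem {γ z : ℝ} (hγ : 0 < γ) (hz : 0 ≤ z) :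
    thresholdMinimizer γ z ∈ Icc (-γ) γ := by
  unfold thresholdMinimizer
  split_ifs with h
  · have h1 := (tanh_half_mem_Ioo hγ).2
    have h2 : 0 < 1 - z := by linarith
    have h3 : 0 ≤ Real.log ((1 + z) / (1 - z)) :=
      Real.log_nonneg ((one_le_div h2).2 (by linarith))
    refine ⟨by linarith, (Real.log_le_iff_le_exp (by positivity)).2 ?_⟩
    rw [div_le_iff₀ h2]
    rw [tanh_half_eq, le_div_iff₀ (by positivity)] at h
    linarith
  · exact ⟨by linarith, le_rfl⟩

theorem isSymmetricGap_threshold {γ : ℝ} (hγ : 0 < γ) :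
    IsSymmetricGap univ (thresholdLoss γ) (thresholdMinimizer γ)
      (thresholdLink (Real.tanh (γ / 2))) := by
  have ht := tanh_half_mem_Ioo hγ
  have hγe := Real.exp_pos γ
  have hexp {z : ℝ} (hz : 0 ≤ z) (hz' : z ≤ Real.tanh (γ / 2)) :
      Real.exp (Real.log ((1 + z) / (1 - z))) = (1 + z) / (1 - z) :=
    Real.exp_log (div_pos (by linarith) (by linarith [ht.2]))
  have hclip0 : clip γ 0 = 0 := clip_of_mem ⟨by linarith, hγ.le⟩
  refine ⟨fun _ _ => mem_univ _, mem_univ _, fun _ _ => mem_univ _, ?_,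
    fun a _ => thresholdLoss_neg γ a, ?_, fun z hz a _ => ?_, fun z hz a _ ha => ?_,
    fun z hz => ?_⟩
  · exact Measurable.ite measurableSet_Iic (Real.measurable_log.comp (by fun_prop))
      measurable_const
  · rw [thresholdMinimizer, if_pos ht.1.le]
    simp
  · rw [condRisk_thresholdLoss hγ, condRisk_thresholdLoss hγ,
      clip_of_mem (thresholdMinimizer_mem hγ hz.1)]
    -- Before the cap, the tangent at the minimizer has slope p, which is the optimality claim. At
    -- the cap its slope is at most p, and `clip γ a ≤ γ` gives the sign of the remainder.
    have htan := log_one_add_exp_tangent_le (clip γ a) (thresholdMinimizer γ z)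
    have hc := clip_le hγ a
    unfold thresholdMinimizer at htan ⊢
    split_ifs at htan ⊢ with h
    · have h2 : 1 - z ≠ 0 := by linarith [ht.2]
      have h3 : (1 + z) / (1 - z) / (1 + (1 + z) / (1 - z)) = (1 + z) / 2 := by
        field_simp
        ring
      rw [hexp hz.1 h, h3] at htan
      rw [hexp hz.1 h]
      linarith
    · have h3 : Real.exp γ / (1 + Real.exp γ) = (1 + Real.tanh (γ / 2)) / 2 := by
        rw [one_add_tanh_half]
        field_simp
      rw [h3] at htan
      nlinarith
  · rw [condRisk_thresholdLoss hγ, condRisk_thresholdLoss hγ, hclip0]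
    -- The tangent at 0 has slope 1/2 ≤ p, and the clipped prediction is nonpositive.
    have htan := log_one_add_exp_tangent_le (clip γ a) 0
    have hc := mul_nonneg hz.1 (neg_nonneg.2 (clip_nonpos hγ ha))
    norm_num at htan ⊢
    linarith
  · rw [condRisk_thresholdLoss hγ, condRisk_thresholdLoss hγ, hclip0,
      clip_of_mem (thresholdMinimizer_mem hγ hz.1), thresholdMinimizer, thresholdLink]
    norm_num
    split_ifs with h
    · have h2 : 0 < 1 - z := by linarith [ht.2]
      have h3 : 0 < 1 + z := by linarith [hz.1]
      rw [hexp hz.1 h, show 1 + (1 + z) / (1 - z) = 2 / (1 - z) by field_simp; ring,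
        Real.log_div h3.ne' h2.ne', Real.log_div two_ne_zero h2.ne']
      ring
    · rw [one_add_tanh_half, one_sub_tanh_half, Real.log_div (by positivity) (by positivity),
        Real.log_div (by positivity) (by positivity), Real.log_mul (by positivity) (by positivity),
        Real.log_exp]
      ring

theorem continuous_thresholdLink (z₀ : ℝ) : Continuous (thresholdLink z₀) := by
  have h1 : Continuous fun z : ℝ => (1 + z) * Real.log (1 + z) :=
    Real.continuous_mul_log.comp (by fun_prop : Continuous fun z : ℝ => 1 + z)
  have h2 : Continuous fun z : ℝ => (1 - z) * Real.log (1 - z) :=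
    Real.continuous_mul_log.comp (by fun_prop : Continuous fun z : ℝ => 1 - z)
  exact Continuous.if_le ((h1.add h2).div_const 2) (by fun_prop) continuous_id continuous_const
    fun z hz => by rw [show z = z₀ from hz]

theorem thresholdLink_isLittleO {z₀ : ℝ} (hz₀ : 0 < z₀) :
    (fun z => thresholdLink z₀ z - 1 / 2 * z ^ 2) =o[𝓝 0] fun z : ℝ => z ^ 2 := by
  -- Near 0 only the branch z ≤ z₀ counts; the bound 1 keeps log(1 - z) differentiable.
  have hd {z : ℝ} (hz : z ∈ Ioo (-1 : ℝ) (min z₀ 1)) :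
      HasDerivAt (thresholdLink z₀) ((Real.log (1 + z) - Real.log (1 - z)) / 2) z := by
    have h1 : 1 + z ≠ 0 := by linarith [hz.1]
    have h2 : 1 - z ≠ 0 := by linarith [hz.2, min_le_right z₀ 1]
    have d1 := (hasDerivAt_id z).const_add 1
    have d2 := (hasDerivAt_id z).const_sub 1
    have d3 : HasDerivAt
        (fun z : ℝ => ((1 + z) * Real.log (1 + z) + (1 - z) * Real.log (1 - z)) / 2)
        ((Real.log (1 + z) - Real.log (1 - z)) / 2) z := by
      refine (((d1.mul (d1.log h1)).add (d2.mul (d2.log h2))).div_const 2).congr_deriv ?_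
      simp only [id]
      field_simp
      ring
    refine d3.congr_of_eventuallyEq ?_
    filter_upwards [Iio_mem_nhds (hz.2.trans_le (min_le_left _ _))] with x hx
    rw [thresholdLink, if_pos (le_of_lt hx)]
  refine isLittleO_sub_sq_of_hasDerivAt
    (f' := fun z => (Real.log (1 + z) - Real.log (1 - z)) / 2) ?_ (by simp) ?_ ?_
  · rw [thresholdLink, if_pos hz₀.le]
    simp
  · filter_upwards [Ioo_mem_nhds (show (-1 : ℝ) < 0 by norm_num) (lt_min hz₀ one_pos)] with z hz
      using hd hz
  · refine (((((hasDerivAt_id (0 : ℝ)).const_add 1).log (by norm_num)).sub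
      (((hasDerivAt_id (0 : ℝ)).const_sub 1).log (by norm_num))).div_const 2).congr_deriv ?_
    norm_num

theorem isLinkFunction_threshold (X : Type*) [MeasurableSpace X] {γ : ℝ} (hγ : 0 < γ) :
    IsLinkFunction X univ (thresholdLoss γ) (thresholdLink (Real.tanh (γ / 2))) :=
  (isSymmetricGap_threshold hγ).isLinkFunction (thresholdLoss_one_pos hγ _).le
    (fun y => (isEquivalentLoss_thresholdLoss hγ y).1) (continuous_thresholdLink _).continuousOn

/-- A larger threshold allows more clipped predictions and leaves the risk at 0 unchanged, so the
gap can only grow. -/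
theorem thresholdLink_tanh_half_le {γ γ' z : ℝ} (hγ' : 0 < γ') (h : γ' ≤ γ)
    (hz : z ∈ Icc (0 : ℝ) 1) :
    thresholdLink (Real.tanh (γ' / 2)) z ≤ thresholdLink (Real.tanh (γ / 2)) z := by
  have hγ : 0 < γ := hγ'.trans_le h
  have hmem := thresholdMinimizer_mem hγ' hz.1
  have h1 := (isSymmetricGap_threshold hγ).condRisk_minimizer_le z hz
    (thresholdMinimizer γ' z) (mem_univ _)
  rw [(isSymmetricGap_threshold hγ).eq_sub z hz, (isSymmetricGap_threshold hγ').eq_sub z hz,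
    condRisk_thresholdLoss hγ' _ 0, condRisk_thresholdLoss hγ _ 0,
    clip_of_mem ⟨by linarith, hγ.le⟩, clip_of_mem ⟨by linarith, hγ'.le⟩]
  refine sub_le_sub_left (h1.trans_eq ?_) _
  rw [condRisk_thresholdLoss hγ', condRisk_thresholdLoss hγ, clip_of_mem hmem,
    clip_of_mem ⟨by linarith [hmem.1], hmem.2.trans h⟩]

/-- With γ' = 2 artanh z₀ ≤ γ, the function is the gap for the threshold γ'; it inherits its
regularity from there and the risk bound from γ. -/
theorem isLinkFunction_threshold_of_le (X : Type*) [MeasurableSpace X] {γ z₀ : ℝ} (hγ : 0 < γ)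
    (h0 : 0 < z₀) (h : z₀ ≤ Real.tanh (γ / 2)) :
    IsLinkFunction X univ (thresholdLoss γ) (thresholdLink z₀) := by
  have hz1 : z₀ < 1 := h.trans_lt (tanh_half_mem_Ioo hγ).2
  have hγ' : 0 < 2 * Real.artanh z₀ := mul_pos two_pos (Real.artanh_pos ⟨h0, hz1⟩)
  have htanh : Real.tanh (2 * Real.artanh z₀ / 2) = z₀ := by
    rw [mul_div_cancel_left₀ _ two_ne_zero, Real.tanh_artanh ⟨by linarith, hz1⟩]
  have hle : 2 * Real.artanh z₀ ≤ γ := by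
    have := Real.artanh_le_artanh (by linarith) (tanh_half_mem_Ioo hγ).2 h
    rw [Real.artanh_tanh] at this
    linarith
  have hgap := isSymmetricGap_threshold hγ'
  have hmono (z : ℝ) (hz : z ∈ Icc (0 : ℝ) 1) := thresholdLink_tanh_half_le hγ' hle hz
  rw [htanh] at hgap hmono
  exact (isLinkFunction_threshold X hγ).mono (continuous_thresholdLink _).continuousOn
    hgap.nonneg hgap.monotoneOn hmono

/-! ### The point z₀ -/

/-- As -γ/(1+e^{-γ}) = γ/(1+e^γ) - γ, a factor splits off. It is at least 1, and without it the
expression is tanh(γ/2). -/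
theorem thresholdPoint_eq (γ : ℝ) : thresholdPoint γ
    = 2 / (Real.exp (γ / (1 + Real.exp γ)) * (1 + Real.exp (-γ))) - 1 := by
  have h0 := Real.exp_pos γ
  have h1 : -γ / (1 + Real.exp (-γ)) = γ / (1 + Real.exp γ) + -γ := by
    rw [Real.exp_neg]
    field_simp
    ring
  rw [thresholdPoint, h1, Real.exp_add, div_eq_mul_inv (2 : ℝ), mul_add, mul_one]

/-- Positivity says that the tangent of log(1 + eᵃ) at -γ lies strictly below log 2 at a = 0. -/
theorem thresholdPoint_pos {γ : ℝ} (hγ : 0 < γ) : 0 < thresholdPoint γ := by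
  have h0 := Real.exp_pos γ
  have h1 := log_one_add_exp_tangent_lt (a := 0) (b := -γ) (by linarith)
  have h2 : Real.exp (-γ) / (1 + Real.exp (-γ)) * (0 - -γ) = γ / (1 + Real.exp γ) := by
    rw [Real.exp_neg]
    field_simp
    ring
  rw [h2, Real.exp_zero, Real.lt_log_iff_exp_lt (by norm_num), Real.exp_add,
    Real.exp_log (by positivity), mul_comm] at h1
  rw [thresholdPoint_eq, sub_pos, one_lt_div (by positivity)]
  linarith

theorem thresholdPoint_le_tanh {γ : ℝ} (hγ : 0 < γ) :
    thresholdPoint γ ≤ Real.tanh (γ / 2) := by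
  have h0 := Real.exp_pos γ
  have h1 : 1 ≤ Real.exp (γ / (1 + Real.exp γ)) := Real.one_le_exp (by positivity)
  have h2 : Real.tanh (γ / 2) = 2 / (1 + Real.exp (-γ)) - 1 := by
    rw [eq_sub_iff_add_eq, add_comm, one_add_tanh_half, Real.exp_neg]
    field_simp
    ring
  rw [thresholdPoint_eq, h2]
  refine sub_le_sub_right (div_le_div_of_nonneg_left (by norm_num) (by positivity) ?_) _
  exact le_mul_of_one_le_left (by positivity) h1

/-! ### The dilogarithm -/

theorem measurable_log_one_sub_div : Measurable fun u : ℝ => Real.log (1 - u) / u :=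
  (Real.measurable_log.comp (measurable_const.sub measurable_id)).div measurable_id

/-- On (0, 1) the integrand is dominated by 1 - log(1 - u), since -(1 - u) log(1 - u) ≤ u. -/
theorem integrableOn_log_one_sub_div :
    IntegrableOn (fun u : ℝ => Real.log (1 - u) / u) (Icc 0 1) := by
  rw [integrableOn_Icc_iff_integrableOn_Ioo]
  have hlog : IntervalIntegrable (fun u : ℝ => Real.log (1 - u)) volume 0 1 := by
    have := (intervalIntegral.intervalIntegrable_log' (a := 1) (b := 0)).comp_sub_left 1
    simpa using this
  have hlog' : IntegrableOn (fun u : ℝ => 1 - Real.log (1 - u)) (Ioo 0 1) := by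
    rw [← integrableOn_Ioc_iff_integrableOn_Ioo]
    exact (integrableOn_const (by simp)).sub
      ((intervalIntegrable_iff_integrableOn_Ioc_of_le zero_le_one).1 hlog)
  refine Integrable.mono' hlog' measurable_log_one_sub_div.aestronglyMeasurable ?_
  refine (ae_restrict_iff' measurableSet_Ioo).2 (ae_of_all _ fun u hu => ?_)
  have h1 : 0 < 1 - u := by linarith [hu.2]
  have h2 := Real.log_nonpos h1.le (by linarith [hu.1])
  have h3 := mul_log_le zero_le_one (inv_pos.2 h1)
  rw [Real.norm_eq_abs, abs_of_nonpos (div_nonpos_of_nonpos_of_nonneg h2 hu.1.le), ← neg_div,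
    div_le_iff₀ hu.1]
  have h4 := mul_le_mul_of_nonneg_left h3 h1.le
  rw [Real.log_inv, Real.log_one] at h4
  have h5 := mul_inv_cancel₀ h1.ne'
  nlinarith

theorem continuousOn_Li₂ : ContinuousOn Li₂ (Icc 0 1) := by
  have h := intervalIntegral.continuousOn_primitive_interval
    (by simpa using integrableOn_log_one_sub_div :
      IntegrableOn (fun u : ℝ => Real.log (1 - u) / u) (uIcc 0 1))
  rw [uIcc_of_le zero_le_one] at h
  exact h.neg

theorem hasDerivAt_Li₂ {x : ℝ} (hx : x ∈ Ioo (0 : ℝ) 1) :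
    HasDerivAt Li₂ (-(Real.log (1 - x) / x)) x := by
  refine (intervalIntegral.integral_hasDerivAt_right ?_
    measurable_log_one_sub_div.stronglyMeasurable.stronglyMeasurableAtFilter ?_).neg
  · exact (intervalIntegrable_iff_integrableOn_Icc_of_le hx.1.le).2
      (integrableOn_log_one_sub_div.mono_set (Icc_subset_Icc_right hx.2.le))
  · exact ((continuousAt_const.sub continuousAt_id).log (by simp; linarith [hx.2])).div
      continuousAt_id (ne_of_gt hx.1)

/-! ### Entropy uncertainty -/

/-- The conditional risk of the entropy loss in terms of the predicted probability `q`. -/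
noncomputable def entropyCondRisk (p q : ℝ) : ℝ :=
  q * Real.log q + (1 - q) * Real.log (1 - q) - p * Li₂ q - (1 - p) * Li₂ (1 - q) + Li₂ 1

theorem entropyLoss_one (a : ℝ) : entropyLoss a 1 = entropyCondRisk 1 (prob a) := by
  norm_num [entropyLoss, entropyCondRisk]

theorem entropyLoss_neg_one (a : ℝ) : entropyLoss a (-1) = entropyCondRisk 0 (prob a) := by
  norm_num [entropyLoss, entropyCondRisk]

theorem condRisk_entropyLoss (p a : ℝ) :
    condRisk entropyLoss p a = entropyCondRisk p (prob a) := by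
  rw [condRisk, entropyLoss_one, entropyLoss_neg_one]
  unfold entropyCondRisk
  ring

theorem entropyLoss_neg (a : ℝ) : entropyLoss (-a) 1 = entropyLoss a (-1) := by
  rw [entropyLoss_one, entropyLoss_neg_one, prob_neg]
  unfold entropyCondRisk
  rw [sub_sub_cancel]
  ring

theorem continuousOn_Li₂_one_sub : ContinuousOn (fun q => Li₂ (1 - q)) (Icc 0 1) :=
  continuousOn_Li₂.comp (by fun_prop) fun q hq => ⟨by linarith [hq.2], by linarith [hq.1]⟩

theorem continuousOn_entropyCondRisk (p : ℝ) : ContinuousOn (entropyCondRisk p) (Icc 0 1) := by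
  have h1 : Continuous fun q : ℝ => q * Real.log q := Real.continuous_mul_log
  have h2 : Continuous fun q : ℝ => (1 - q) * Real.log (1 - q) :=
    Real.continuous_mul_log.comp (by fun_prop : Continuous fun q : ℝ => 1 - q)
  exact ((((h1.add h2).continuousOn).sub (continuousOn_const.mul continuousOn_Li₂)).sub
    (continuousOn_const.mul continuousOn_Li₂_one_sub)).add continuousOn_const

/-- The factor p - q, times a nonpositive one, puts the minimum at q = p. The value p = 1 gives the
derivative of the loss for the label +1. -/
theorem hasDerivAt_entropyCondRisk (p : ℝ) {q : ℝ} (hq : q ∈ Ioo (0 : ℝ) 1) :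
    HasDerivAt (entropyCondRisk p)
      ((p - q) * (Real.log q / (1 - q) + Real.log (1 - q) / q)) q := by
  have h0 : q ≠ 0 := hq.1.ne'
  have h1 : 1 - q ≠ 0 := by linarith [hq.2]
  have d := (hasDerivAt_id q).const_sub 1
  have dL : HasDerivAt (fun q => Li₂ (1 - q)) (Real.log q / (1 - q)) q := by
    refine ((hasDerivAt_Li₂ (x := 1 - q) ⟨by linarith [hq.2], by linarith [hq.1]⟩).comp q
      d).congr_deriv ?_
    rw [sub_sub_cancel]
    ring
  refine ((((((hasDerivAt_id q).mul (Real.hasDerivAt_log h0)).add (d.mul (d.log h1))).sub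
    ((hasDerivAt_Li₂ hq).const_mul p)).sub (dL.const_mul (1 - p))).add_const _).congr_deriv ?_
  simp only [id]
  field_simp
  ring

theorem log_div_add_log_div_nonpos {q : ℝ} (hq : q ∈ Ioo (0 : ℝ) 1) :
    Real.log q / (1 - q) + Real.log (1 - q) / q ≤ 0 := by
  have h1 : 0 < 1 - q := by linarith [hq.2]
  exact add_nonpos
    (div_nonpos_of_nonpos_of_nonneg (Real.log_nonpos hq.1.le hq.2.le) h1.le)
    (div_nonpos_of_nonpos_of_nonneg (Real.log_nonpos h1.le (by linarith [hq.1])) hq.1.le)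

theorem antitoneOn_entropyCondRisk {p : ℝ} (hp : p ≤ 1) :
    AntitoneOn (entropyCondRisk p) (Icc 0 p) := by
  have hsub : Ioo 0 p ⊆ Ioo (0 : ℝ) 1 := Ioo_subset_Ioo_right hp
  refine antitoneOn_of_deriv_nonpos (convex_Icc 0 p)
    ((continuousOn_entropyCondRisk p).mono (Icc_subset_Icc_right hp)) ?_ ?_ <;>
    rw [interior_Icc]
  · exact fun q hq =>
      (hasDerivAt_entropyCondRisk p (hsub hq)).differentiableAt.differentiableWithinAt
  · intro q hq
    rw [(hasDerivAt_entropyCondRisk p (hsub hq)).deriv]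
    exact mul_nonpos_of_nonneg_of_nonpos (by linarith [hq.2]) (log_div_add_log_div_nonpos (hsub hq))

theorem monotoneOn_entropyCondRisk {p : ℝ} (hp : 0 ≤ p) :
    MonotoneOn (entropyCondRisk p) (Icc p 1) := by
  have hsub : Ioo p 1 ⊆ Ioo (0 : ℝ) 1 := Ioo_subset_Ioo_left hp
  refine monotoneOn_of_deriv_nonneg (convex_Icc p 1)
    ((continuousOn_entropyCondRisk p).mono (Icc_subset_Icc_left hp)) ?_ ?_ <;>
    rw [interior_Icc]
  · exact fun q hq =>
      (hasDerivAt_entropyCondRisk p (hsub hq)).differentiableAt.differentiableWithinAt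
  · intro q hq
    rw [(hasDerivAt_entropyCondRisk p (hsub hq)).deriv]
    exact mul_nonneg_of_nonpos_of_nonpos (by linarith [hq.1]) (log_div_add_log_div_nonpos (hsub hq))

theorem prob_mem_Icc {a : ℝ} (ha : a ∈ Icc (-1 : ℝ) 1) : prob a ∈ Icc (0 : ℝ) 1 := by
  unfold prob
  exact ⟨by linarith [ha.1], by linarith [ha.2]⟩

theorem isEquivalentLoss_entropyLoss :
    IsEquivalentLoss (Icc (-1) 1) ∅ entropyUncertainty crossEntropy entropyLoss := by
  refine isEquivalentLoss_of_symmetric neg_mem_Icc_neg_one_one neg_mem_interior_Icc_neg_one_one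
    (fun a => ?_) crossEntropy_neg entropyLoss_neg ?_ fun a ha => ?_
  · rw [entropyUncertainty, entropyUncertainty, one_sub_prob_neg, prob_neg, add_comm]
  · simp only [entropyLoss_one]
    exact (continuousOn_entropyCondRisk 1).comp
      (fun a _ => (hasDerivAt_prob a).continuousAt.continuousWithinAt) fun a => prob_mem_Icc
  · rw [interior_Icc, sdiff_empty] at ha
    refine ⟨_, hasDerivAt_crossEntropy_one ha.1, ?_⟩
    simp only [entropyLoss_one]
    have hq : prob a ∈ Ioo (0 : ℝ) 1 := by
      unfold prob
      exact ⟨by linarith [ha.1], by linarith [ha.2]⟩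
    refine ((hasDerivAt_entropyCondRisk 1 hq).comp a (hasDerivAt_prob a)).congr_deriv ?_
    have h0 : prob a ≠ 0 := hq.1.ne'
    have h1 : 1 - prob a ≠ 0 := by linarith [hq.2]
    rw [show 1 + a = 2 * prob a by unfold prob; ring, entropyUncertainty]
    field_simp

theorem entropyLink_eq {z : ℝ} (hz : z ∈ Ioc (-1 : ℝ) 1) : entropyLink z
    = entropyCondRisk ((1 + z) / 2) (1 / 2) - entropyCondRisk ((1 + z) / 2) ((1 + z) / 2) := by
  have h1 : 1 + z ≠ 0 := by linarith [hz.1]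
  unfold entropyLink entropyCondRisk
  rw [show 1 - (1 + z) / 2 = (1 - z) / 2 by ring, show (1 : ℝ) - 1 / 2 = 1 / 2 by norm_num,
    Real.log_div h1 two_ne_zero, Real.log_div one_ne_zero two_ne_zero, Real.log_one]
  -- At z = 1 the logarithm of (1 - z)/2 cannot be split, but its coefficient is 0.
  rcases hz.2.eq_or_lt with rfl | h
  · norm_num
    ring
  · rw [Real.log_div (by linarith) two_ne_zero]
    ring

theorem isSymmetricGap_entropy : IsSymmetricGap (Icc (-1) 1) entropyLoss id entropyLink := by
  have hprob0 : prob 0 = 1 / 2 := by norm_num [prob]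
  refine ⟨neg_mem_Icc_neg_one_one, by norm_num, fun z hz => ⟨by simp; linarith [hz.1], hz.2⟩,
    measurable_id, fun a _ => entropyLoss_neg a, rfl, fun z hz a ha => ?_,
    fun z hz a ha ha0 => ?_, fun z hz => ?_⟩
  · rw [id, condRisk_entropyLoss, condRisk_entropyLoss]
    have hp := prob_mem_Icc (a := z) ⟨by linarith [hz.1], hz.2⟩
    have hq := prob_mem_Icc ha
    change entropyCondRisk (prob z) (prob z) ≤ _
    rcases le_total (prob a) (prob z) with h | h
    · exact antitoneOn_entropyCondRisk hp.2 ⟨hq.1, h⟩ ⟨hp.1, le_rfl⟩ h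
    · exact monotoneOn_entropyCondRisk hp.1 ⟨le_rfl, hp.2⟩ ⟨h, hq.2⟩ h
  · rw [condRisk_entropyLoss, condRisk_entropyLoss, hprob0]
    have hq := prob_mem_Icc ha
    have h1 : prob a ≤ 1 / 2 := by
      unfold prob
      linarith
    exact antitoneOn_entropyCondRisk (by linarith [hz.2]) ⟨hq.1, by linarith [hz.1]⟩
      ⟨by norm_num, by linarith [hz.1]⟩ h1
  · rw [id, condRisk_entropyLoss, condRisk_entropyLoss, hprob0,
      entropyLink_eq ⟨by linarith [hz.1], hz.2⟩, prob]

theorem continuousOn_entropyLink : ContinuousOn entropyLink (Icc 0 1) := by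
  have hL : ContinuousOn (fun z : ℝ => Li₂ ((1 + z) / 2)) (Icc 0 1) :=
    continuousOn_Li₂.comp (by fun_prop) fun z hz => ⟨by linarith [hz.1], by linarith [hz.2]⟩
  have hL' : ContinuousOn (fun z : ℝ => Li₂ ((1 - z) / 2)) (Icc 0 1) :=
    continuousOn_Li₂.comp (by fun_prop) fun z hz => ⟨by linarith [hz.2], by linarith [hz.1]⟩
  have h1 : Continuous fun z : ℝ => (1 + z) / 2 * Real.log (1 + z) := by
    have := (Real.continuous_mul_log.comp
      (by fun_prop : Continuous fun z : ℝ => 1 + z)).div_const 2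
    exact this.congr fun z => by simp only [Function.comp_apply]; ring
  have h2 : Continuous fun z : ℝ => (1 - z) / 2 * Real.log (1 - z) := by
    have := (Real.continuous_mul_log.comp
      (by fun_prop : Continuous fun z : ℝ => 1 - z)).div_const 2
    exact this.congr fun z => by simp only [Function.comp_apply]; ring
  unfold entropyLink
  exact (((((by fun_prop : ContinuousOn (fun z : ℝ => (1 + z) / 2) (Icc 0 1)).mul hL).add
    ((by fun_prop : ContinuousOn (fun z : ℝ => (1 - z) / 2) (Icc 0 1)).mul hL')).sub
    continuousOn_const).sub h1.continuousOn).sub h2.continuousOn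

theorem hasDerivAt_Li₂_one_add_half {z : ℝ} (hz : z ∈ Ioo (-1 : ℝ) 1) :
    HasDerivAt (fun z => Li₂ ((1 + z) / 2)) (-(Real.log ((1 - z) / 2) / (1 + z))) z := by
  have h1 : 1 + z ≠ 0 := by linarith [hz.1]
  refine ((hasDerivAt_Li₂ (x := (1 + z) / 2) ⟨by linarith [hz.1], by linarith [hz.2]⟩).comp z
    (((hasDerivAt_id z).const_add 1).div_const 2)).congr_deriv ?_
  rw [show 1 - (1 + z) / 2 = (1 - z) / 2 by ring]
  field_simp

theorem hasDerivAt_Li₂_one_sub_half {z : ℝ} (hz : z ∈ Ioo (-1 : ℝ) 1) :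
    HasDerivAt (fun z => Li₂ ((1 - z) / 2)) (Real.log ((1 + z) / 2) / (1 - z)) z := by
  have h := (hasDerivAt_Li₂_one_add_half (z := -z) ⟨by linarith [hz.2], by linarith [hz.1]⟩).comp z
    (hasDerivAt_neg z)
  simp only [Function.comp_def, ← sub_eq_add_neg, sub_neg_eq_add] at h
  exact h.congr_deriv (by ring)

/-- The logarithms from differentiating `Li₂` cancel those from the entropy terms. -/
theorem hasDerivAt_entropyLink {z : ℝ} (hz : z ∈ Ioo (-1 : ℝ) 1) :
    HasDerivAt entropyLink ((Li₂ ((1 + z) / 2) - Li₂ ((1 - z) / 2)) / 2) z := by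
  have h1 : 1 + z ≠ 0 := by linarith [hz.1]
  have h2 : 1 - z ≠ 0 := by linarith [hz.2]
  have d1 := (hasDerivAt_id z).const_add 1
  have d2 := (hasDerivAt_id z).const_sub 1
  refine ((((((d1.div_const 2).mul (hasDerivAt_Li₂_one_add_half hz)).add
    ((d2.div_const 2).mul (hasDerivAt_Li₂_one_sub_half hz))).sub_const (Li₂ (1 / 2))).sub
    ((d1.div_const 2).mul (d1.log h1))).sub ((d2.div_const 2).mul (d2.log h2))).congr_deriv ?_
  simp only [id]
  rw [Real.log_div h1 two_ne_zero, Real.log_div h2 two_ne_zero]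
  field_simp
  ring

theorem entropyLink_isLittleO :
    (fun z => entropyLink z - Real.log 2 / 2 * z ^ 2) =o[𝓝 0] fun z : ℝ => z ^ 2 := by
  have h0 : (0 : ℝ) ∈ Ioo (-1 : ℝ) 1 := by norm_num
  refine isLittleO_sub_sq_of_hasDerivAt
    (f' := fun z => (Li₂ ((1 + z) / 2) - Li₂ ((1 - z) / 2)) / 2)
    isSymmetricGap_entropy.map_zero (by simp) ?_ ?_
  · filter_upwards [Ioo_mem_nhds h0.1 h0.2] with z hz using hasDerivAt_entropyLink hz
  · refine (((hasDerivAt_Li₂_one_add_half h0).sub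
      (hasDerivAt_Li₂_one_sub_half h0)).div_const 2).congr_deriv ?_
    norm_num
    rw [one_div, Real.log_inv]
    ring

theorem isLinkFunction_entropy (X : Type*) [MeasurableSpace X] :
    IsLinkFunction X (Icc (-1) 1) entropyLoss entropyLink :=
  isSymmetricGap_entropy.isLinkFunction
    -- The added constant `Li₂ 1` makes the loss vanish at q = 1 for the label +1.
    (by rw [id, entropyLoss_one]; norm_num [prob, entropyCondRisk])
    (fun y => (isEquivalentLoss_entropyLoss y).1) continuousOn_entropyLink

end UncertaintySampling

/-! ### The four cases -/

theorem proposition3p1 {X : Type*} [MeasurableSpace X] :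
    -- entropy uncertainty and cross-entropy loss
    (IsEquivalentLoss (Set.Icc (-1) 1) ∅ entropyUncertainty crossEntropy entropyLoss ∧
      IsSurrogate X (Set.Icc (-1) 1) entropyLoss ∧
      IsLinkFunction X (Set.Icc (-1) 1) entropyLoss entropyLink ∧
      IsPsiTransform (Set.Icc (-1) 1) entropyLoss entropyLink ∧
      (fun z => entropyLink z - Real.log 2 / 2 * z ^ 2) =o[nhds 0] (fun z : ℝ => z ^ 2)) ∧
    -- least confidence uncertainty and cross-entropy loss
    (IsEquivalentLoss (Set.Icc (-1) 1) ∅ leastConfidenceUncertainty crossEntropy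
        leastConfidenceLoss ∧
      IsSurrogate X (Set.Icc (-1) 1) leastConfidenceLoss ∧
      IsLinkFunction X (Set.Icc (-1) 1) leastConfidenceLoss leastConfidenceLink ∧
      IsPsiTransform (Set.Icc (-1) 1) leastConfidenceLoss leastConfidenceLink ∧
      (fun z => leastConfidenceLink z - 1 / 4 * z ^ 2) =o[nhds 0] (fun z : ℝ => z ^ 2)) ∧
    -- margin-based uncertainty and squared hinge loss
    (∀ μ : ℝ, 0 < μ →
      IsEquivalentLoss Set.univ ∅ (marginUncertainty μ) squaredHinge (marginLoss μ) ∧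
      IsSurrogate X Set.univ (marginLoss μ) ∧
      IsLinkFunction X Set.univ (marginLoss μ) (marginLink μ) ∧
      IsPsiTransform Set.univ (marginLoss μ) (marginLink μ) ∧
      (fun z => marginLink μ z - z ^ 2) =o[nhds 0] (fun z : ℝ => z ^ 2)) ∧
    -- threshold-based uncertainty and logistic loss
    (∀ γ : ℝ, 0 < γ →
      IsEquivalentLoss Set.univ {-γ, γ} (thresholdUncertainty γ) logisticLoss
        (thresholdLoss γ) ∧
      IsSurrogate X Set.univ (thresholdLoss γ) ∧
      IsLinkFunction X Set.univ (thresholdLoss γ) (thresholdLink (thresholdPoint γ)) ∧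
      (fun z => thresholdLink (thresholdPoint γ) z - 1 / 2 * z ^ 2) =o[nhds 0]
        (fun z : ℝ => z ^ 2) ∧
      -- the ψ-transform itself has the same form, with the larger point `tanh (γ / 2)`
      thresholdPoint γ ≤ Real.tanh (γ / 2) ∧
      IsLinkFunction X Set.univ (thresholdLoss γ) (thresholdLink (Real.tanh (γ / 2))) ∧
      IsPsiTransform Set.univ (thresholdLoss γ) (thresholdLink (Real.tanh (γ / 2))) ∧
      (fun z => thresholdLink (Real.tanh (γ / 2)) z - 1 / 2 * z ^ 2) =o[nhds 0]
        (fun z : ℝ => z ^ 2)) := by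
  refine ⟨⟨isEquivalentLoss_entropyLoss, ⟨_, isLinkFunction_entropy X⟩, isLinkFunction_entropy X,
      isSymmetricGap_entropy.isPsiTransform continuousOn_entropyLink, entropyLink_isLittleO⟩,
    ⟨isEquivalentLoss_leastConfidenceLoss, ⟨_, isLinkFunction_leastConfidence X⟩,
      isLinkFunction_leastConfidence X,
      isSymmetricGap_leastConfidence.isPsiTransform continuousOn_leastConfidenceLink,
      leastConfidenceLink_isLittleO⟩,
    fun μ hμ => ⟨isEquivalentLoss_marginLoss hμ, ⟨_, isLinkFunction_margin X hμ⟩,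
      isLinkFunction_margin X hμ,
      (isSymmetricGap_margin hμ).isPsiTransform (continuousOn_marginLink hμ),
      marginLink_isLittleO hμ⟩,
    fun γ hγ => ⟨isEquivalentLoss_thresholdLoss hγ, ⟨_, isLinkFunction_threshold X hγ⟩,
      isLinkFunction_threshold_of_le X hγ (thresholdPoint_pos hγ) (thresholdPoint_le_tanh hγ),
      thresholdLink_isLittleO (thresholdPoint_pos hγ), thresholdPoint_le_tanh hγ,
      isLinkFunction_threshold X hγ,
      (isSymmetricGap_threshold hγ).isPsiTransform (continuous_thresholdLink _).continuousOn,
      thresholdLink_isLittleO (tanh_half_mem_Ioo hγ).1⟩⟩
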